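/- Let $p$ be a prime and $P$ a finite $p$-group. A fusion system $\mathcal F$ on $P$ consists of the subgroups of $P$ and, for subgroups $R,S\le P$, a set $\mathrm{Hom}_{\mathcal F}(R,S)$ of injective homomorphisms $R\to S$, closed under composition, containing all maps $R\to S$ induced by conjugation by elements of $P$, closed under restricting the codomain of a morphism to its image, and closed under inverting isomorphisms; write $\mathrm{Aut}_{\mathcal F}(R)=\mathrm{Hom}_{\mathcal F}(R,R)$. A subgroup $R$ is fully normalized if $|N_P(R)|\ge|N_P(S)|$ for every $S$ that is $\mathcal F$-isomorphic to $R$. The system $\mathcal F$ is saturated if $\mathrm{Inn}(P)$ is a Sylow $p$-subgroup of $\mathrm{Aut}_{\mathcal F}(P)$ and every morphism $\phi:R\to P$ in $\mathcal F$ with fully normalized image extends to a morphism $N_\phi\to P$ in $\mathcal F$, where $N_\phi$ is the set of $x\in N_P(R)$ for which there is $y\in N_P(\phi(R))$ with $\phi(x^{-1}gx)=y^{-1}\phi(g)y$ for all $g\in R$. A subgroup $R$ is: $\mathcal F$-centric if $C_P(S)\le S$ for every $S$ that is $\mathcal F$-isomorphic to $R$; $\mathcal F$-radical if $O_p(\mathrm{Aut}_{\mathcal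 F}(R))=\mathrm{Inn}(R)$; weakly $\mathcal F$-closed if it is $\mathcal F$-isomorphic only to itself; strongly $\mathcal F$-closed if every $\mathcal F$-morphism whose domain is contained in $R$ has image contained in $R$. For $Q\le P$, $N_{\mathcal F}(Q)$ is the fusion system on $N_P(Q)$ whose morphisms $R\to S$ are the $\phi\in\mathrm{Hom}_{\mathcal F}(R,S)$ that extend to some $\bar\phi\in\mathrm{Hom}_{\mathcal F}(QR,QS)$ with $\bar\phi|_Q\in\mathrm{Aut}(Q)$, and $\mathcal F_Q(Q)$ is the fusion system on $Q$ whose morphisms are the maps induced by conjugation by elements of $Q$. A subsystem $\mathcal E$ of $\mathcal F$ on a subgroup $Q\le P$ is normal, written $\mathcal E\trianglelefteq\mathcal F$, if $Q$ is strongly $\mathcal F$-closed, $\mathcal E$ is saturated, and for all $R\le S\le Q$, $\phi\in\mathrm{Hom}_{\mathcal E}(R,S)$ and $\psi\in\mathrm{Hom}_{\mathcal F}(S,P)$ the homomorphism $\psi(R)\to Q$, $\psi(x)\mapsto\psi(\phi(x))$, is a morphism of $\mathcal E$. A central series for $Q$ is a chain $1=Q_0\le Q_1\le\dots\le Q_n=Q$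 of normal subgroups of $Q$ with $Q_{i+1}/Q_i\le Z(Q/Q_i)$ for all $i<n$; its terms are $Q_0,\dots,Q_n$. **Theorem C.** Let $\mathcal F$ be a saturated fusion system on a finite $p$-group $P$, and let $Q$ be a subgroup of $P$. The following are equivalent: (i) $\mathcal F=N_{\mathcal F}(Q)$; (ii) $\mathcal F_Q(Q)\trianglelefteq\mathcal F$; (iii) $Q$ is strongly $\mathcal F$-closed and is contained in every fully normalized, $\mathcal F$-centric, $\mathcal F$-radical subgroup of $P$; (iv) there is a central series for $Q$ all of whose terms are strongly $\mathcal F$-closed; (v) $Q$ is strongly $\mathcal F$-closed and there is a central series for $Q$ all of whose terms are weakly $\mathcal F$-closed. -/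

import Mathlib

/-- A fusion system on a subgroup `base` of a group `P`: for all subgroups `Q`, `R` of `base` a set
`Hom Q R` of injective homomorphisms `Q → R`, closed under composition, containing all maps
induced by conjugation by elements of `base`, closed under restricting the codomain to the image,
and closed under inverting isomorphisms.  Pairs of subgroups that are not both contained in `base`
have no morphisms between them, so that two fusion systems with the same objects and morphisms
are equal. -/
@[ext]
structure FusionSystem (P : Type*) [Group P] where
  base : Subgroup P
  Hom : ∀ Q R : Subgroup P, Set (Q →* R)
  le_base : ∀ {Q R : Subgroup P} {φ : Q →* R}, φ ∈ Hom Q R → Q ≤ base ∧ R ≤ base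
  injective : ∀ {Q R : Subgroup P} {φ : Q →* R}, φ ∈ Hom Q R → Function.Injective φ
  comp_mem : ∀ {Q R S : Subgroup P} {φ : Q →* R} {ψ : R →* S},
    φ ∈ Hom Q R → ψ ∈ Hom R S → ψ.comp φ ∈ Hom Q S
  conj_mem : ∀ {Q R : Subgroup P}, Q ≤ base → R ≤ base → ∀ g ∈ base, ∀ φ : Q →* R,
    (∀ x : Q, (φ x : P) = g⁻¹ * x * g) → φ ∈ Hom Q R
  range_mem : ∀ {Q R : Subgroup P} {φ : Q →* R}, φ ∈ Hom Q R →
    (R.subtype.comp φ).rangeRestrict ∈ Hom Q (R.subtype.comp φ).range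
  symm_mem : ∀ {Q R : Subgroup P} {e : Q ≃* R},
    e.toMonoidHom ∈ Hom Q R → e.symm.toMonoidHom ∈ Hom R Q

namespace FusionSystem

variable {P : Type*} [Group P]

/-- `φ̄ : Q' → R'` extends `φ : Q → R`. -/
def Extends {Q R Q' R' : Subgroup P} (φ' : Q' →* R') (φ : Q →* R) : Prop :=
  ∃ h : Q ≤ Q', ∀ x : Q, (φ' (Subgroup.inclusion h x) : P) = φ x

/-- The normalizer of `Q` in the group on which `F` lives. -/
def baseNormalizer (F : FusionSystem P) (Q : Subgroup P) : Subgroup P :=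
  F.base ⊓ Subgroup.normalizer (Q : Set P)

/-- `Q` and `R` are `F`-isomorphic. -/
def IsIso (F : FusionSystem P) (Q R : Subgroup P) : Prop :=
  ∃ e : Q ≃* R, e.toMonoidHom ∈ F.Hom Q R

/-- `Q` is fully normalized in `F`. -/
def IsFullyNormalized (F : FusionSystem P) (Q : Subgroup P) : Prop :=
  Q ≤ F.base ∧ ∀ R : Subgroup P, F.IsIso Q R →
    Nat.card (F.baseNormalizer R) ≤ Nat.card (F.baseNormalizer Q)

/-- The group `Aut_F(Q)`. -/
def aut (F : FusionSystem P) (Q : Subgroup P) (hQ : Q ≤ F.base) : Subgroup (MulAut Q) where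
  carrier := {e | MulEquiv.toMonoidHom e ∈ F.Hom Q Q}
  one_mem' := F.conj_mem hQ hQ 1 (one_mem _) _ (by intro x; simp)
  mul_mem' := fun {_ _} ha hb => F.comp_mem hb ha
  inv_mem' := fun {_} ha => F.symm_mem ha

/-- The group `Inn(Q)` of inner automorphisms. -/
def inn (Q : Subgroup P) : Subgroup (MulAut Q) := (MulAut.conj : Q →* MulAut Q).range

/-- The subgroup generated by all normal `p`-subgroups of a group; for a finite group `H` this is
its largest normal `p`-subgroup `O_p(H)`. -/
def pCore (p : ℕ) (H : Type*) [Group H] : Subgroup H :=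
  sSup {N : Subgroup H | N.Normal ∧ IsPGroup p N}

/-- `N_φ`, for `φ : Q → R`: the elements `x` normalizing `Q` for which there is an element `y`
normalizing the image of `φ` with `φ (x⁻¹ g x) = y⁻¹ φ(g) y` for all `g` in `Q`. -/
def extender (F : FusionSystem P) {Q R : Subgroup P} (φ : Q →* R) : Subgroup P where
  carrier := {x | x ∈ F.baseNormalizer Q ∧ ∃ y ∈ F.baseNormalizer (R.subtype.comp φ).range,
    ∀ g g' : Q, (g' : P) = x⁻¹ * g * x → (φ g' : P) = y⁻¹ * φ g * y}
  one_mem' := ⟨one_mem _, 1, one_mem _, fun g g' h => by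
    have : g' = g := Subtype.ext (by simpa using h)
    simp [this]⟩
  mul_mem' := by
    rintro a b ⟨ha, y, hy, hay⟩ ⟨hb, z, hz, hbz⟩
    refine ⟨mul_mem ha hb, y * z, mul_mem hy hz, fun g g' h => ?_⟩
    have h1 : a⁻¹ * (g : P) * a ∈ Q := (Subgroup.mem_normalizer_iff''.1 ha.2 _).1 g.2
    rw [hbz ⟨_, h1⟩ g' (by simp [h, mul_assoc]), hay g ⟨_, h1⟩ rfl]
    simp [mul_assoc]
  inv_mem' := by
    rintro a ⟨ha, y, hy, hay⟩
    refine ⟨inv_mem ha, y⁻¹, inv_mem hy, fun g g' h => ?_⟩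
    rw [hay g' g (by simp [h, mul_assoc])]
    simp [mul_assoc]

/-- `F` is saturated (with respect to the prime `p`): `Inn(S)` is a Sylow `p`-subgroup of
`Aut_F(S)`, where `S` is the group on which `F` lives, and each morphism `φ : Q → S` in `F` with
fully normalized image extends to a morphism `N_φ → S` in `F`. -/
def IsSaturated (p : ℕ) (F : FusionSystem P) : Prop :=
  (∃ T : Sylow p (F.aut F.base le_rfl),
    (T : Subgroup (F.aut F.base le_rfl)) = (inn F.base).subgroupOf (F.aut F.base le_rfl)) ∧
  ∀ (Q : Subgroup P) (φ : Q →* F.base), φ ∈ F.Hom Q F.base →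
    F.IsFullyNormalized (F.base.subtype.comp φ).range →
    ∃ φ' ∈ F.Hom (F.extender φ) F.base, Extends φ' φ

/-- `Q` is `F`-centric: each subgroup `F`-isomorphic to `Q` contains its centralizer. -/
def IsCentric (F : FusionSystem P) (Q : Subgroup P) : Prop :=
  Q ≤ F.base ∧ ∀ R : Subgroup P, F.IsIso Q R → F.base ⊓ Subgroup.centralizer (R : Set P) ≤ R

/-- `Q` is `F`-radical: `O_p(Aut_F(Q)) = Inn(Q)`. -/
def IsRadical (p : ℕ) (F : FusionSystem P) (Q : Subgroup P) : Prop :=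
  ∃ hQ : Q ≤ F.base, pCore p (F.aut Q hQ) = (inn Q).subgroupOf (F.aut Q hQ)

/-- `Q` is weakly `F`-closed: it is `F`-isomorphic only to itself. -/
def IsWeaklyClosed (F : FusionSystem P) (Q : Subgroup P) : Prop :=
  Q ≤ F.base ∧ ∀ R : Subgroup P, F.IsIso Q R → R = Q

/-- `Q` is strongly `F`-closed: each morphism in `F` from a subgroup of `Q` has image in `Q`. -/
def IsStronglyClosed (F : FusionSystem P) (Q : Subgroup P) : Prop :=
  Q ≤ F.base ∧ ∀ (R S : Subgroup P), R ≤ Q → ∀ φ ∈ F.Hom R S, ∀ x : R, (φ x : P) ∈ Q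

/-- `E` is a subsystem of `F`. -/
def IsSubsystem (E F : FusionSystem P) : Prop :=
  E.base ≤ F.base ∧ ∀ R S : Subgroup P, E.Hom R S ⊆ F.Hom R S

/-- The subsystem `E` of `F`, on a strongly `F`-closed subgroup, is `F`-invariant: for
`R ≤ S ≤ E.base`, `φ : R → S` in `E` and `ψ : S → F.base` in `F`, the homomorphism
`ψ(R) → E.base`, `ψ(x) ↦ ψ(φ(x))` is in `E`. -/
def IsInvariant (E F : FusionSystem P) : Prop :=
  E.IsSubsystem F ∧ F.IsStronglyClosed E.base ∧
  ∀ (R S : Subgroup P) (hRS : R ≤ S), S ≤ E.base → ∀ φ ∈ E.Hom R S, ∀ ψ ∈ F.Hom S F.base,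
    ∃ χ ∈ E.Hom ((F.base.subtype.comp ψ).comp (Subgroup.inclusion hRS)).range E.base,
      ∀ x : R, (χ (((F.base.subtype.comp ψ).comp (Subgroup.inclusion hRS)).rangeRestrict x) : P)
        = ψ (φ x)

/-- `E` is normal in `F`: it is `F`-invariant and saturated. -/
def IsNormalIn (p : ℕ) (E F : FusionSystem P) : Prop :=
  E.IsInvariant F ∧ E.IsSaturated p

/-- The fusion system `F_Q(Q)` on `Q`, whose morphisms are the conjugations by elements of `Q`. -/
def inner (Q : Subgroup P) : FusionSystem P where
  base := Q
  Hom R S := {φ | R ≤ Q ∧ S ≤ Q ∧ ∃ g ∈ Q, ∀ x : R, (φ x : P) = g⁻¹ * x * g}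
  le_base h := ⟨h.1, h.2.1⟩
  injective := by
    rintro R S φ ⟨-, -, g, -, h⟩ x y hxy
    have := h x
    rw [hxy, h y] at this
    exact Subtype.ext (by simpa using this.symm)
  comp_mem := by
    rintro R S T φ ψ ⟨hR, -, g, hg, h⟩ ⟨-, hT, k, hk, h'⟩
    exact ⟨hR, hT, g * k, mul_mem hg hk, fun x => by simp [h', h, mul_assoc]⟩
  conj_mem hR hS g hg φ h := ⟨hR, hS, g, hg, h⟩
  range_mem := by
    rintro R S φ ⟨hR, hS, g, hg, h⟩
    refine ⟨hR, ?_, g, hg, fun x => h x⟩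
    rintro _ ⟨x, rfl⟩
    exact hS (φ x).2
  symm_mem := by
    rintro R S e ⟨hR, hS, g, hg, h⟩
    refine ⟨hS, hR, g⁻¹, inv_mem hg, fun x => ?_⟩
    have := h (e.symm x)
    simp only [MulEquiv.toMonoidHom_eq_coe, MonoidHom.coe_coe, MulEquiv.apply_symm_apply] at this ⊢
    rw [this]
    simp [mul_assoc]

theorem sup_le_normalizer (F : FusionSystem P) {Q R : Subgroup P} (hQ : Q ≤ F.base)
    (hR : R ≤ F.baseNormalizer Q) : Q ⊔ R ≤ F.baseNormalizer Q :=
  sup_le (le_inf hQ Subgroup.le_normalizer) hR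

/-- The image of `Q ⊔ R` under an extension of `φ` that restricts to an automorphism of `Q`. -/
theorem range_extension {Q R S : Subgroup P} (φ : R →* S) (φ' : ↥(Q ⊔ R) →* ↥(Q ⊔ S))
    (h : Extends φ' φ) (α : MulAut Q)
    (hα : ∀ x : Q, (φ' (Subgroup.inclusion le_sup_left x) : P) = α x) :
    ((Q ⊔ S).subtype.comp φ').range = Q ⊔ (S.subtype.comp φ).range := by
  obtain ⟨hR, h⟩ := h
  apply le_antisymm
  · rw [MonoidHom.range_eq_map, Subgroup.map_le_iff_le_comap]
    have key : (Q ⊔ R) ≤ ((Q ⊔ (S.subtype.comp φ).range).comap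
        ((Q ⊔ S).subtype.comp φ')).map (Q ⊔ R).subtype := by
      refine sup_le (fun x hx => ?_) (fun x hx => ?_)
      · refine ⟨⟨x, le_sup_left (a := Q) hx⟩, ?_, rfl⟩
        have := hα ⟨x, hx⟩
        simp only [Subgroup.coe_comap, Set.mem_preimage, SetLike.mem_coe]
        change (φ' (Subgroup.inclusion le_sup_left ⟨x, hx⟩) : P) ∈ _
        rw [this]
        exact le_sup_left (a := Q) (α ⟨x, hx⟩).2
      · refine ⟨⟨x, hR hx⟩, ?_, rfl⟩
        have := h ⟨x, hx⟩
        simp only [Subgroup.coe_comap, Set.mem_preimage, SetLike.mem_coe]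
        change (φ' (Subgroup.inclusion hR ⟨x, hx⟩) : P) ∈ _
        rw [this]
        exact le_sup_right (a := Q) ⟨⟨x, hx⟩, rfl⟩
    rintro x -
    obtain ⟨y, hy, hyx⟩ := key x.2
    rwa [← Subtype.ext (a1 := y) (a2 := x) hyx]
  · refine sup_le (fun x hx => ?_) ?_
    · refine ⟨Subgroup.inclusion le_sup_left (α.symm ⟨x, hx⟩), ?_⟩
      have := hα (α.symm ⟨x, hx⟩)
      simpa using this
    · rintro _ ⟨x, rfl⟩
      exact ⟨Subgroup.inclusion hR x, h x⟩

/-- The normalizer `N_F(Q)`: the fusion system on the normalizer of `Q` whose morphisms `R → S`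
are the morphisms in `F` that extend to a morphism `QR → QS` in `F` restricting to an automorphism
of `Q`. -/
def normalizer (F : FusionSystem P) (Q : Subgroup P) (hQ : Q ≤ F.base) : FusionSystem P where
  base := F.baseNormalizer Q
  Hom R S := {φ | R ≤ F.baseNormalizer Q ∧ S ≤ F.baseNormalizer Q ∧ φ ∈ F.Hom R S ∧
    ∃ φ' ∈ F.Hom (Q ⊔ R) (Q ⊔ S), Extends φ' φ ∧
      ∃ α : MulAut Q, ∀ x : Q, (φ' (Subgroup.inclusion le_sup_left x) : P) = α x}
  le_base h := ⟨h.1, h.2.1⟩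
  injective h := F.injective h.2.2.1
  comp_mem := by
    rintro R S T φ ψ ⟨hR, hS, hφ, φ', hφ', ⟨e1, h1⟩, α, hα⟩ ⟨-, hT, hψ, ψ', hψ', ⟨e2, h2⟩, β, hβ⟩
    refine ⟨hR, hT, F.comp_mem hφ hψ, ψ'.comp φ', F.comp_mem hφ' hψ', ⟨e1, fun x => ?_⟩,
      β * α, fun x => ?_⟩
    · have : φ' (Subgroup.inclusion e1 x) = Subgroup.inclusion e2 (φ x) := Subtype.ext (h1 x)
      simp only [MonoidHom.comp_apply, this, h2]
    · have : φ' (Subgroup.inclusion le_sup_left x) = Subgroup.inclusion le_sup_left (α x) :=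
        Subtype.ext (hα x)
      simp only [MonoidHom.comp_apply, this, hβ, MulAut.mul_apply]
  conj_mem := by
    intro R S hR hS g hg φ h
    have hg' := Subgroup.mem_normalizer_iff''.1 hg.2
    have hmap : ∀ x ∈ Q ⊔ R, g⁻¹ * x * g ∈ Q ⊔ S := by
      have : Q ⊔ R ≤ (Q ⊔ S).comap (MulAut.conj g⁻¹).toMonoidHom := by
        refine sup_le (fun x hx => ?_) (fun x hx => ?_)
        · exact le_sup_left (a := Q) (by simpa using (hg' x).1 hx)
        · have := (φ ⟨x, hx⟩).2
          rw [h ⟨x, hx⟩] at this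
          exact le_sup_right (a := Q) (by simpa using this)
      intro x hx
      simpa using this hx
    let φ' : ↥(Q ⊔ R) →* ↥(Q ⊔ S) :=
      { toFun := fun x => ⟨g⁻¹ * x * g, hmap x x.2⟩
        map_one' := by ext; simp
        map_mul' := fun x y => by ext; simp [mul_assoc] }
    have hQR : ∀ {T : Subgroup P}, T ≤ F.baseNormalizer Q → Q ⊔ T ≤ F.base := fun hT =>
      (F.sup_le_normalizer hQ hT).trans inf_le_left
    refine ⟨hR, hS, F.conj_mem (hR.trans inf_le_left) (hS.trans inf_le_left) g hg.1 φ h, φ',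
      F.conj_mem (hQR hR) (hQR hS) g hg.1 φ' (fun x => rfl), ⟨le_sup_right, fun x => (h x).symm⟩,
      { toFun := fun x => ⟨g⁻¹ * x * g, (hg' x).1 x.2⟩
        invFun := fun x => ⟨g * x * g⁻¹, (Subgroup.mem_normalizer_iff.1 hg.2 x).1 x.2⟩
        left_inv := fun x => by ext; simp [mul_assoc]
        right_inv := fun x => by ext; simp [mul_assoc]
        map_mul' := fun x y => by ext; simp [mul_assoc] }, fun x => rfl⟩
  range_mem := by
    rintro R S φ ⟨hR, hS, hφ, φ', hφ', hext, α, hα⟩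
    have hr := range_extension φ φ' hext α hα
    obtain ⟨e1, h1⟩ := hext
    refine ⟨hR, ?_, F.range_mem hφ, ?_⟩
    · rintro _ ⟨x, rfl⟩
      exact hS (φ x).2
    · have := F.range_mem hφ'
      have key : ∀ T : Subgroup P, ((Q ⊔ S).subtype.comp φ').range = T →
          ∃ χ ∈ F.Hom (Q ⊔ R) T, ∀ x, (χ x : P) = φ' x := by
        rintro _ rfl
        exact ⟨_, this, fun x => rfl⟩
      obtain ⟨χ, hχ, hχφ⟩ := key _ hr
      exact ⟨χ, hχ, ⟨e1, fun x => (hχφ _).trans (h1 x)⟩, α, fun x => (hχφ _).trans (hα x)⟩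
  symm_mem := by
    rintro R S e ⟨hR, hS, he, φ', hφ', hext, α, hα⟩
    have hr := range_extension _ φ' hext α hα
    obtain ⟨e1, h1⟩ := hext
    have hrange : (S.subtype.comp e.toMonoidHom).range = S := by
      ext x
      constructor
      · rintro ⟨y, rfl⟩
        exact (e y).2
      · exact fun hx => ⟨e.symm ⟨x, hx⟩, by simp⟩
    rw [hrange] at hr
    have hsurj : Function.Surjective φ' := by
      intro y
      have hy : (y : P) ∈ ((Q ⊔ S).subtype.comp φ').range := by rw [hr]; exact y.2
      obtain ⟨x, hx⟩ := hy
      exact ⟨x, Subtype.ext hx⟩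
    let ε : ↥(Q ⊔ R) ≃* ↥(Q ⊔ S) := MulEquiv.ofBijective φ' ⟨F.injective hφ', hsurj⟩
    have hε : ε.toMonoidHom ∈ F.Hom (Q ⊔ R) (Q ⊔ S) := hφ'
    refine ⟨hS, hR, F.symm_mem he, ε.symm.toMonoidHom, F.symm_mem hε,
      ⟨le_sup_right, fun x => ?_⟩, α⁻¹, fun x => ?_⟩
    · have : Subgroup.inclusion le_sup_right x = ε (Subgroup.inclusion e1 (e.symm x)) :=
        Subtype.ext (by
          have := h1 (e.symm x)
          change (x : P) = φ' _
          simpa using this.symm)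
      rw [this]
      change ((ε.symm (ε _) : ↥(Q ⊔ R)) : P) = _
      rw [MulEquiv.symm_apply_apply]
      rfl
    · have : Subgroup.inclusion le_sup_left x =
          ε (Subgroup.inclusion le_sup_left (α⁻¹ x)) :=
        Subtype.ext (by
          have := hα (α⁻¹ x)
          change (x : P) = φ' _
          simpa using this.symm)
      rw [this]
      change ((ε.symm (ε _) : ↥(Q ⊔ R)) : P) = _
      rw [MulEquiv.symm_apply_apply]
      rfl

/-- `1 = C 0 ≤ C 1 ≤ ⋯ ≤ C n = Q` is a central series for `Q`; the condition `[C (i+1), Q] ≤ C i`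
says that `C i` is normal in `Q` and that `C (i+1) / C i` is central in `Q / C i`. -/
def IsCentralSeries (Q : Subgroup P) (n : ℕ) (C : ℕ → Subgroup P) : Prop :=
  C 0 = ⊥ ∧ C n = Q ∧ ∀ i < n, C i ≤ C (i + 1) ∧ ⁅C (i + 1), Q⁆ ≤ C i

theorem le_base_of_eq_top {F : FusionSystem P} (hF : F.base = ⊤) (Q : Subgroup P) :
    Q ≤ F.base := hF ▸ le_top

end FusionSystem

/-! The implications form two loops, (i) → (ii) → (iii) → (i) and (i) → (iv) → (v) → (iii).

From (i), every morphism extends to one that restricts to an automorphism of `Q`. Hence every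
characteristic subgroup of `Q` is strongly closed. This applies to `Q` itself and to the terms of
its upper central series, which gives (iv). Conjugation by `g ∈ Q` is carried by a morphism to
conjugation by the image of `g` under the extension, which gives (ii).

For (iii) → (i), it suffices to extend each `f` from `R` to `QR`, by downward induction on the order
of `R` (`IsSaturated.extendsToSup`). If `T` is a fully normalized conjugate of `R`, then `f` factors
through an automorphism `α` of `T` and two isomorphisms onto `T` that extend to normalizers. If `T`
is not centric or not radical, then `α` extends beyond `T`; otherwise `Q ≤ T` and there is nothing
to extend. This uses that `Aut_P(T)` is Sylow in `Aut_F(T)` for every fully normalized `T`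
(`IsSaturated.aut_le_autP`), whereas the definition of saturation grants this only for `T = P`.

For (ii) → (iii) and (v) → (iii), let `T` be centric and radical. A normal `p`-subgroup of
`Aut_F(T)` is inner, so an element of `P` inducing a member of it lies in `T`
(`IsRadical.mem_of_aut_mem`). Automorphisms acting trivially on the quotients of an invariant chain
of `T` form such a subgroup, and the relevant elements normalizing `T` induce members of it. Since a
normal subgroup `A` of `P` with `N_A(T) ≤ T` lies in `T`, this yields `Q ≤ T`.

Morphisms are handled as functions `P → P` of which only the values on the domain matter; this
avoids coercions between subgroup types. -/

namespace FusionSystem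

/-! ### Morphisms of a fusion system as functions on the whole group -/

section Morphisms

variable {P : Type*} [Group P] {F : FusionSystem P} {R S T : Subgroup P} {f g : P → P}

/-- The restriction of the function `f` to `R` is a morphism from `R` to `S` in `F`. -/
def Mor (F : FusionSystem P) (R S : Subgroup P) (f : P → P) : Prop :=
  ∃ φ ∈ F.Hom R S, ∀ x : R, (φ x : P) = f x

/-- The restriction of the function `f` to `R` is an isomorphism from `R` to `S` in `F`. -/
def MIso (F : FusionSystem P) (R S : Subgroup P) (f : P → P) : Prop :=
  F.Mor R S f ∧ ∀ y ∈ S, ∃ x ∈ R, f x = y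

open Classical in
theorem exists_mor {φ : R →* S} (h : φ ∈ F.Hom R S) :
    ∃ f, F.Mor R S f ∧ ∀ x : R, (φ x : P) = f x :=
  have key : ∀ x : R, (φ x : P) = (if h : (x : P) ∈ R then (φ ⟨x, h⟩ : P) else 1) :=
    fun x => by simp
  -- The value `1` outside `R` is arbitrary.
  ⟨fun x => if h : x ∈ R then φ ⟨x, h⟩ else 1, ⟨φ, h, key⟩, key⟩

theorem Mor.congr (h : F.Mor R S f) (hfg : ∀ x ∈ R, g x = f x) : F.Mor R S g := by
  obtain ⟨φ, hφ, h⟩ := h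
  exact ⟨φ, hφ, fun x => (h x).trans (hfg x x.2).symm⟩

theorem Mor.mem (h : F.Mor R S f) {x : P} (hx : x ∈ R) : f x ∈ S := by
  obtain ⟨φ, hφ, h⟩ := h
  rw [← h ⟨x, hx⟩]
  exact (φ _).2

theorem Mor.map_mul (h : F.Mor R S f) {x y : P} (hx : x ∈ R) (hy : y ∈ R) :
    f (x * y) = f x * f y := by
  obtain ⟨φ, hφ, h⟩ := h
  rw [← h ⟨x, hx⟩, ← h ⟨y, hy⟩, ← h ⟨x * y, mul_mem hx hy⟩, ← Subgroup.coe_mul,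
    ← _root_.map_mul]
  rfl

theorem Mor.map_one (h : F.Mor R S f) : f 1 = 1 := by
  have := h.map_mul (one_mem R) (one_mem R)
  simpa using this

theorem Mor.map_inv (h : F.Mor R S f) {x : P} (hx : x ∈ R) : f x⁻¹ = (f x)⁻¹ := by
  have := h.map_mul (inv_mem hx) hx
  rw [inv_mul_cancel, h.map_one] at this
  exact eq_inv_of_mul_eq_one_left this.symm

theorem Mor.map_conj (h : F.Mor R S f) {x y : P} (hx : x ∈ R) (hy : y ∈ R) :
    f (x⁻¹ * y * x) = (f x)⁻¹ * f y * f x := by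
  rw [h.map_mul (mul_mem (inv_mem hx) hy) hx, h.map_mul (inv_mem hx) hy, h.map_inv hx]

theorem Mor.inj (h : F.Mor R S f) {x y : P} (hx : x ∈ R) (hy : y ∈ R) (hxy : f x = f y) :
    x = y := by
  obtain ⟨φ, hφ, h⟩ := h
  rw [← h ⟨x, hx⟩, ← h ⟨y, hy⟩] at hxy
  exact congrArg Subtype.val (F.injective hφ (Subtype.ext hxy))

theorem Mor.comp (hf : F.Mor R S f) (hg : F.Mor S T g) : F.Mor R T (fun x => g (f x)) := by
  obtain ⟨φ, hφ, h⟩ := hf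
  obtain ⟨ψ, hψ, h'⟩ := hg
  exact ⟨ψ.comp φ, F.comp_mem hφ hψ, fun x => by simp [h', h]⟩

theorem mor_conj (hR : R ≤ F.base) (hS : S ≤ F.base) {g : P} (hg : g ∈ F.base)
    (h : ∀ x ∈ R, g⁻¹ * x * g ∈ S) : F.Mor R S (fun x => g⁻¹ * x * g) := by
  let φ : R →* S :=
    { toFun := fun x => ⟨g⁻¹ * x * g, h x x.2⟩
      map_one' := by ext; simp
      map_mul' := fun x y => by ext; simp [mul_assoc] }
  exact ⟨φ, F.conj_mem hR hS g hg φ fun x => rfl, fun x => rfl⟩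

theorem mor_id (hS : S ≤ F.base) (h : R ≤ S) : F.Mor R S (fun x => x) :=
  (mor_conj (h.trans hS) hS (one_mem _) (by simpa using fun x hx => h hx)).congr (by simp)

theorem Mor.exists_image (h : F.Mor R S f) : ∃ T ≤ S, F.MIso R T f := by
  obtain ⟨φ, hφ, h⟩ := h
  refine ⟨(S.subtype.comp φ).range, ?_, ⟨_, F.range_mem hφ, fun x => h x⟩, ?_⟩
  · rintro _ ⟨x, rfl⟩
    exact (φ x).2
  · rintro _ ⟨x, rfl⟩
    exact ⟨x, x.2, (h x).symm⟩

/-- Restriction is not an axiom, but inclusions are conjugations by `1`: precompose with one, pass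
to the image, and include the image in `S'`. -/
theorem Mor.restrict (h : F.Mor R S f) {R' S' : Subgroup P} (hR : R' ≤ R)
    (hS : S' ≤ F.base) (hRS : ∀ x ∈ R', f x ∈ S') : F.Mor R' S' f := by
  have hRb : R ≤ F.base := by
    obtain ⟨φ, hφ, -⟩ := h
    exact (F.le_base hφ).1
  obtain ⟨T, -, hT⟩ := ((mor_id hRb hR).comp h).exists_image
  refine hT.1.comp (mor_id hS fun y hy => ?_)
  obtain ⟨x, hx, rfl⟩ := hT.2 y hy
  exact hRS x hx

theorem MIso.exists_symm (h : F.MIso R S f) :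
    ∃ g, F.MIso S R g ∧ (∀ x ∈ R, g (f x) = x) ∧ ∀ y ∈ S, f (g y) = y := by
  obtain ⟨⟨φ, hφ, h⟩, hs⟩ := h
  have hsurj : Function.Surjective φ := fun y => by
    obtain ⟨x, hx, hxy⟩ := hs y y.2
    exact ⟨⟨x, hx⟩, Subtype.ext ((h _).trans hxy)⟩
  let e : R ≃* S := MulEquiv.ofBijective φ ⟨F.injective hφ, hsurj⟩
  have he : e.symm.toMonoidHom ∈ F.Hom S R := F.symm_mem (e := e) hφ
  obtain ⟨g, hg, hge⟩ := exists_mor he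
  have hgf : ∀ x ∈ R, g (f x) = x := fun x hx => by
    have h1 : (e ⟨x, hx⟩ : P) = f x := h ⟨x, hx⟩
    rw [← h1, ← hge]
    simp
  refine ⟨g, ⟨hg, fun x hx => ⟨f x, ?_, hgf x hx⟩⟩, hgf, fun y hy => ?_⟩
  · rw [← h ⟨x, hx⟩]
    exact (φ _).2
  · obtain ⟨x, hx, rfl⟩ := hs y hy
    rw [hgf x hx]

theorem isIso_iff : F.IsIso R S ↔ ∃ f, F.MIso R S f := by
  constructor
  · rintro ⟨e, he⟩
    obtain ⟨f, hf, hef⟩ := exists_mor he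
    refine ⟨f, hf, fun y hy => ⟨e.symm ⟨y, hy⟩, (e.symm _).2, ?_⟩⟩
    rw [← hef]
    simp
  · rintro ⟨f, ⟨φ, hφ, h⟩, hs⟩
    have hsurj : Function.Surjective φ := fun y => by
      obtain ⟨x, hx, hxy⟩ := hs y y.2
      exact ⟨⟨x, hx⟩, Subtype.ext ((h _).trans hxy)⟩
    exact ⟨MulEquiv.ofBijective φ ⟨F.injective hφ, hsurj⟩, hφ⟩

theorem MIso.comp (hf : F.MIso R S f) (hg : F.MIso S T g) : F.MIso R T (fun x => g (f x)) := by
  refine ⟨hf.1.comp hg.1, fun z hz => ?_⟩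
  obtain ⟨y, hy, rfl⟩ := hg.2 z hz
  obtain ⟨x, hx, rfl⟩ := hf.2 y hy
  exact ⟨x, hx, rfl⟩

theorem MIso.card_eq (h : F.MIso R S f) : Nat.card R = Nat.card S := by
  obtain ⟨e, -⟩ := isIso_iff.2 ⟨f, h⟩
  exact Nat.card_congr e.toEquiv

theorem MIso.refl (hS : S ≤ F.base) : F.MIso S S (fun x => x) :=
  ⟨mor_id hS le_rfl, fun y hy => ⟨y, hy, rfl⟩⟩

theorem Mor.mIso_self [Finite P] (h : F.Mor R R f) : F.MIso R R f := by
  refine ⟨h, ?_⟩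
  obtain ⟨φ, hφ, h⟩ := h
  intro y hy
  obtain ⟨x, hx⟩ := Finite.surjective_of_injective (F.injective hφ) ⟨y, hy⟩
  exact ⟨x, x.2, by rw [← h, hx]⟩

theorem Mor.exists_aut [Finite P] (hR : R ≤ F.base) (h : F.Mor R R f) :
    ∃ α : F.aut R hR, ∀ x : R, ((α : MulAut R) x : P) = f x := by
  obtain ⟨φ, hφ, h⟩ := h
  exact ⟨⟨MulEquiv.ofBijective φ ⟨F.injective hφ, Finite.surjective_of_injective (F.injective hφ)⟩,
    hφ⟩, h⟩

theorem exists_mIso_of_aut {hR : R ≤ F.base} (α : F.aut R hR) :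
    ∃ f, F.MIso R R f ∧ ∀ x : R, ((α : MulAut R) x : P) = f x := by
  obtain ⟨f, hf, h⟩ := exists_mor α.2
  have h' : ∀ x : R, ((α : MulAut R) x : P) = f x := h
  refine ⟨f, ⟨hf, fun y hy => ⟨(α : MulAut R).symm ⟨y, hy⟩, Subtype.prop _, ?_⟩⟩, h⟩
  rw [← h']
  simp

theorem IsStronglyClosed.mem {Q : Subgroup P} (hQ : F.IsStronglyClosed Q) (hf : F.Mor R S f)
    {x : P} (hx : x ∈ R) (hxQ : x ∈ Q) : f x ∈ Q := by
  have hR : R ≤ F.base ∧ S ≤ F.base := by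
    obtain ⟨φ, hφ, -⟩ := hf
    exact F.le_base hφ
  obtain ⟨φ, hφ, h⟩ := hf.restrict (inf_le_left : R ⊓ Q ≤ R) hR.2 fun y hy => hf.mem hy.1
  rw [← h ⟨x, hx, hxQ⟩]
  exact hQ.2 _ _ inf_le_right φ hφ _

theorem mem_normalizer_of_forall [Finite P] {y : P} (h : ∀ t ∈ R, y⁻¹ * t * y ∈ R) :
    y ∈ Subgroup.normalizer (R : Set P) := by
  let φ : R → R := fun t => ⟨y⁻¹ * t * y, h t t.2⟩
  have hφ : Function.Injective φ := fun a b hab => by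
    have := congrArg Subtype.val hab
    exact Subtype.ext (by simpa [φ] using this)
  refine Subgroup.mem_normalizer_iff''.2 fun t => ⟨h t, fun ht => ?_⟩
  obtain ⟨s, hs⟩ := Finite.surjective_of_injective hφ ⟨_, ht⟩
  have := congrArg Subtype.val hs
  have h2 : (s : P) = t := by simpa [φ] using this
  exact h2 ▸ s.2

theorem conj_mem_of_mem_normalizer {x g : P} (hx : x ∈ Subgroup.normalizer (R : Set P))
    (hg : g ∈ R) : x⁻¹ * g * x ∈ R :=
  (Subgroup.mem_normalizer_iff''.1 hx g).1 hg

/-- The extension axiom for functions; `E` is `N_f`, of which only the listed properties are needed.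
-/
theorem IsSaturated.extend {p : ℕ} (hF : F.base = ⊤) (hsat : F.IsSaturated p)
    (h : F.MIso R T f) (hT : F.IsFullyNormalized T) :
    ∃ (E : Subgroup P) (f' : P → P), R ≤ E ∧ F.Mor E ⊤ f' ∧ (∀ x ∈ R, f' x = f x) ∧
      ∀ x ∈ Subgroup.normalizer (R : Set P), (∃ y ∈ Subgroup.normalizer (T : Set P),
        ∀ g ∈ R, f (x⁻¹ * g * x) = y⁻¹ * f g * y) → x ∈ E := by
  have hb : ∀ x : P, x ∈ F.base := fun x => hF ▸ Subgroup.mem_top x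
  obtain ⟨φ, hφ, hf⟩ := h.1.restrict le_rfl le_rfl fun x _ => hb (f x)
  have hr : (F.base.subtype.comp φ).range = T := by
    ext y
    constructor
    · rintro ⟨x, rfl⟩
      have : f x ∈ T := h.1.mem x.2
      rwa [← hf] at this
    · intro hy
      obtain ⟨x, hx, rfl⟩ := h.2 y hy
      exact ⟨⟨x, hx⟩, hf _⟩
  obtain ⟨φ', hφ', hle, hext⟩ := hsat.2 R φ hφ (hr.symm ▸ hT)
  obtain ⟨f', hf', hff⟩ := exists_mor hφ'
  refine ⟨F.extender φ, f', hle, hf'.restrict le_rfl hF.ge fun _ _ => Subgroup.mem_top _,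
    fun x hx => ?_, ?_⟩
  · rw [← hf ⟨x, hx⟩, ← hext, hff]
    rfl
  · rintro x hx ⟨y, hy, hxy⟩
    refine ⟨⟨hb x, hx⟩, y, ⟨hb y, ?_⟩, fun g g' hg => ?_⟩
    · rw [hr]
      exact hy
    · rw [hf, hf, hg, hxy g g.2]

theorem IsFullyNormalized.card_le (hF : F.base = ⊤) (hT : F.IsFullyNormalized T)
    (h : F.MIso T R f) : Nat.card (Subgroup.normalizer (R : Set P)) ≤
      Nat.card (Subgroup.normalizer (T : Set P)) := by
  have := hT.2 R (isIso_iff.2 ⟨f, h⟩)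
  simpa only [baseNormalizer, hF, top_inf_eq] using this

theorem exists_fullyNormalized [Finite P] (hR : R ≤ F.base) :
    ∃ T f, F.IsFullyNormalized T ∧ F.MIso R T f := by
  obtain ⟨T, ⟨f, hf⟩, hmax⟩ := Set.exists_max_image {T : Subgroup P | ∃ f, F.MIso R T f}
    (fun T => Nat.card (F.baseNormalizer T)) (Set.toFinite _) ⟨R, _, MIso.refl hR⟩
  refine ⟨T, f, ⟨?_, fun S hS => ?_⟩, hf⟩
  · obtain ⟨⟨φ, hφ, -⟩, -⟩ := hf
    exact (F.le_base hφ).2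
  · obtain ⟨g, hg⟩ := isIso_iff.1 hS
    exact hmax S ⟨_, hf.comp hg⟩

end Morphisms

end FusionSystem

/-! ### Two facts about finite groups -/

theorem Subgroup.exists_mem_normalizer_notMem_of_isPGroup {G : Type*} [Group G] {p : ℕ}
    [Fact p.Prime] {H K : Subgroup G} [Finite K] (hK : IsPGroup p K) (hHK : H < K) :
    ∃ g ∈ K, g ∉ H ∧ g ∈ Subgroup.normalizer (H : Set G) := by
  have := hK.isNilpotent
  have hlt : H.subgroupOf K < ⊤ := by
    rw [lt_top_iff_ne_top, Ne, Subgroup.subgroupOf_eq_top]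
    exact not_le_of_gt hHK
  obtain ⟨-, g, hg, hgH⟩ := SetLike.lt_iff_le_and_exists.1
    (Group.normalizerCondition_of_isNilpotent _ hlt)
  refine ⟨g, g.2, hgH, Subgroup.mem_normalizer_iff.2 fun h => ⟨fun hh => ?_, fun hh => ?_⟩⟩
  · exact (Subgroup.mem_normalizer_iff.1 hg ⟨h, hHK.le hh⟩).1 hh
  · have hk : h ∈ K := by
      have := mul_mem (mul_mem (inv_mem g.2) (hHK.le hh)) g.2
      simpa [mul_assoc] using this
    exact (Subgroup.mem_normalizer_iff.1 hg ⟨h, hk⟩).2 hh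

/-- Some power of `g`, with exponent congruent to `1` modulo `p ^ k`, has `p`-power order. -/
theorem exists_modEq_one_pow_pow_eq_one {G : Type*} [Group G] [Finite G] {p : ℕ}
    (hp : p.Prime) (g : G) (k : ℕ) :
    ∃ e, e ≡ 1 [MOD p ^ k] ∧ ∃ a, (g ^ e) ^ p ^ a = 1 := by
  obtain ⟨a, m, hm, hgm⟩ := Nat.exists_eq_pow_mul_and_not_dvd (orderOf_pos g).ne' p hp.ne_one
  have hco : (p ^ k).Coprime m := Nat.Coprime.pow_left _ ((Nat.Prime.coprime_iff_not_dvd hp).2 hm)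
  -- Being divisible by the `p'`-part `m` of the order, `e` kills that part of `g`.
  obtain ⟨e, he, he'⟩ := Nat.chineseRemainder hco 1 0
  refine ⟨e, he, a, ?_⟩
  obtain ⟨c, rfl⟩ := (Nat.modEq_zero_iff_dvd).1 he'
  rw [← pow_mul, ← orderOf_dvd_iff_pow_eq_one, hgm]
  exact ⟨c, by ring⟩

namespace FusionSystem

/-! ### Automizers of fully normalized subgroups -/

section Automizers

variable {P : Type*} [Group P] {F : FusionSystem P} {R S T : Subgroup P} {f g : P → P}

/-- The transport along `f : R → T` of the group of automorphisms of `R` that are induced by the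
normalizer of `R`. -/
def autConj (F : FusionSystem P) {R T : Subgroup P} (f : P → P) (hT : T ≤ F.base)
    (hf : ∀ x ∈ R, f x ∈ T) : Subgroup (F.aut T hT) where
  carrier := {β | ∃ x ∈ Subgroup.normalizer (R : Set P), ∀ g (hg : g ∈ R),
    ((β : MulAut T) ⟨f g, hf g hg⟩ : P) = f (x⁻¹ * g * x)}
  one_mem' := ⟨1, one_mem _, fun g hg => by simp⟩
  mul_mem' := by
    rintro a b ⟨x, hx, hax⟩ ⟨y, hy, hby⟩
    refine ⟨y * x, mul_mem hy hx, fun g hg => ?_⟩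
    have hg' := conj_mem_of_mem_normalizer hy hg
    have : (b : MulAut T) ⟨f g, hf g hg⟩ = ⟨f (y⁻¹ * g * y), hf _ hg'⟩ := Subtype.ext (hby g hg)
    rw [Subgroup.coe_mul, MulAut.mul_apply, this, hax _ hg']
    simp [mul_assoc]
  inv_mem' := by
    rintro a ⟨x, hx, hax⟩
    refine ⟨x⁻¹, inv_mem hx, fun g hg => ?_⟩
    have hg' := conj_mem_of_mem_normalizer (inv_mem hx) hg
    have : (a : MulAut T) ⟨_, hf _ hg'⟩ = ⟨f g, hf g hg⟩ := Subtype.ext (by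
      rw [hax _ hg']
      simp [mul_assoc])
    rw [Subgroup.coe_inv, ← this, MulAut.inv_apply_self]

/-- The group of automorphisms of `T` that are induced by the normalizer of `T`. -/
def autP (F : FusionSystem P) (T : Subgroup P) (hT : T ≤ F.base) : Subgroup (F.aut T hT) :=
  F.autConj (R := T) (fun x => x) hT fun _ h => h

theorem mem_autP {hT : T ≤ F.base} {α : F.aut T hT} :
    α ∈ F.autP T hT ↔ ∃ x ∈ Subgroup.normalizer (T : Set P), ∀ g : T,
      ((α : MulAut T) g : P) = x⁻¹ * g * x :=
  ⟨fun ⟨x, hx, h⟩ => ⟨x, hx, fun g => h g g.2⟩, fun ⟨x, hx, h⟩ => ⟨x, hx, fun g hg => h ⟨g, hg⟩⟩⟩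

theorem isPGroup_autConj {p : ℕ} (hP : IsPGroup p P) (hT : T ≤ F.base) (hf : ∀ x ∈ R, f x ∈ T)
    (hs : ∀ y ∈ T, ∃ x ∈ R, f x = y) : IsPGroup p (F.autConj f hT hf) := by
  rintro ⟨β, x, hx, h⟩
  obtain ⟨k, hk⟩ := hP x
  refine ⟨k, ?_⟩
  have key : ∀ n g (hg : g ∈ R),
      (((β : MulAut T) ^ n) ⟨f g, hf g hg⟩ : P) = f ((x ^ n)⁻¹ * g * x ^ n) := by
    intro n
    induction n with
    | zero => intro g hg; simp
    | succ n ih =>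
      intro g hg
      have hg' := conj_mem_of_mem_normalizer hx hg
      have : (β : MulAut T) ⟨f g, hf g hg⟩ = ⟨f (x⁻¹ * g * x), hf _ hg'⟩ := Subtype.ext (h g hg)
      rw [pow_succ, MulAut.mul_apply, this, ih _ hg', pow_succ']
      simp [mul_assoc]
  ext ⟨y, hy⟩
  obtain ⟨g, hg, rfl⟩ := hs y hy
  simpa [hk] using key (p ^ k) g hg

theorem isPGroup_autP {p : ℕ} (hP : IsPGroup p P) (hT : T ≤ F.base) :
    IsPGroup p (F.autP T hT) :=
  isPGroup_autConj hP hT _ fun y hy => ⟨y, hy, rfl⟩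

theorem subgroupOf_inn_le_autP (hT : T ≤ F.base) :
    (inn T).subgroupOf (F.aut T hT) ≤ F.autP T hT := by
  rintro α ⟨q, hq⟩
  -- `MulAut.conj q` is `g ↦ q * g * q⁻¹`, the opposite of the convention used for fusion systems.
  refine mem_autP.2 ⟨(q : P)⁻¹, Subgroup.le_normalizer (inv_mem q.2), fun g => ?_⟩
  have : (α : MulAut T) = MulAut.conj q := hq.symm
  rw [this]
  simp

theorem mem_inn_of_forall {hT : T ≤ F.base} {α : F.aut T hT} {x : P} (hx : x ∈ T)
    (h : ∀ g : T, ((α : MulAut T) g : P) = x⁻¹ * g * x) :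
    α ∈ (inn T).subgroupOf (F.aut T hT) := by
  refine ⟨⟨x, hx⟩⁻¹, ?_⟩
  ext g
  have := h g
  simpa using this.symm

theorem exists_aut_conj [Finite P] (hF : F.base = ⊤) (hT : T ≤ F.base) {x : P}
    (hx : x ∈ Subgroup.normalizer (T : Set P)) :
    ∃ α ∈ F.autP T hT, ∀ g : T, ((α : MulAut T) g : P) = x⁻¹ * g * x := by
  obtain ⟨α, hα⟩ := Mor.exists_aut hT (mor_conj hT hT (hF ▸ Subgroup.mem_top x)
    fun g hg => conj_mem_of_mem_normalizer hx hg)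
  exact ⟨α, mem_autP.2 ⟨x, hx, hα⟩, hα⟩

/-- Maximality makes `autP` a Sylow subgroup, so Sylow's conjugacy theorem applies. -/
theorem exists_conj_mem_autP [Finite P] {p : ℕ} [Fact p.Prime] (hP : IsPGroup p P)
    {hT : T ≤ F.base}
    (hmax : ∀ S : Subgroup (F.aut T hT), IsPGroup p S → F.autP T hT ≤ S → S ≤ F.autP T hT)
    {S : Subgroup (F.aut T hT)} (hS : IsPGroup p S) :
    ∃ β : F.aut T hT, ∀ s ∈ S, β * s * β⁻¹ ∈ F.autP T hT := by
  obtain ⟨A, hA⟩ := (isPGroup_autP hP hT).exists_le_sylow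
  obtain ⟨B, hB⟩ := hS.exists_le_sylow
  obtain ⟨β, hβ⟩ := MulAction.exists_smul_eq (F.aut T hT) B A
  refine ⟨β, fun s hs => hmax A A.2 hA ?_⟩
  rw [← hβ]
  exact ⟨s, hB hs, by simp [MulAut.conj_apply]⟩

/-- Downward induction on the order of `T`. A `p`-automorphism `α` normalizing `Aut_P(T)` extends to
`N = N_P(T)`, where a suitable power of the extension is a `p`-element. By induction it becomes
conjugation by some `y` on a fully normalized conjugate of `N`, and full normalization of `T` allows
`y` to be pulled back to `N`. -/
theorem IsSaturated.aut_le_autP [Finite P] {p : ℕ} [Fact p.Prime] (hP : IsPGroup p P)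
    (hF : F.base = ⊤) (hsat : F.IsSaturated p) (T : Subgroup P) (hT : T ≤ F.base)
    (hTn : F.IsFullyNormalized T) (S : Subgroup (F.aut T hT)) (hS : IsPGroup p S)
    (hTS : F.autP T hT ≤ S) : S ≤ F.autP T hT := by
  induction hd : Nat.card P - Nat.card T using Nat.strong_induction_on generalizing T with
  | _ d ih =>
  by_cases hTb : T = F.base
  · subst hTb
    obtain ⟨A, hA⟩ := hsat.1
    have := subgroupOf_inn_le_autP hT
    rw [← hA] at this
    rw [A.3 hS (this.trans hTS)]
    exact this
  have hTlt : T < ⊤ := hF ▸ lt_of_le_of_ne hT hTb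
  by_contra hSle
  obtain ⟨α, hαS, hα, hαn⟩ := Subgroup.exists_mem_normalizer_notMem_of_isPGroup hS
    (lt_of_le_not_ge hTS hSle)
  refine hα ?_
  obtain ⟨f, hf, hαf⟩ := exists_mIso_of_aut α
  set N := Subgroup.normalizer (T : Set P) with hN
  have hb : ∀ U : Subgroup P, U ≤ F.base := fun U => hF ▸ le_top
  obtain ⟨E, f', hTE, hf', hff, hE⟩ := hsat.extend hF hf hTn
  -- As `α` normalizes `Aut_P(T)`, it carries conjugation by `x` to conjugation by some `y`, so
  -- `N_α` is all of `N`.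
  have hNE : N ≤ E := by
    intro x hx
    refine hE x hx ?_
    obtain ⟨β, hβ, hβx⟩ := exists_aut_conj hF hT hx
    obtain ⟨y, hy, hβy⟩ := mem_autP.1 ((Subgroup.mem_normalizer_iff.1 hαn β).1 hβ)
    refine ⟨y, hy, fun g hg => ?_⟩
    have h1 := hβy ((α : MulAut T) ⟨g, hg⟩)
    have h2 : (β : MulAut T) ⟨g, hg⟩ = ⟨x⁻¹ * g * x, conj_mem_of_mem_normalizer hx hg⟩ :=
      Subtype.ext (hβx _)
    simp only [Subgroup.coe_mul, Subgroup.coe_inv, MulAut.mul_apply, MulAut.inv_apply_self, h2,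
      hαf] at h1
    exact h1
  have hTN : T ≤ N := Subgroup.le_normalizer
  have hfN : F.Mor N N f' := hf'.restrict hNE (hb _) fun x hx => by
    refine mem_normalizer_of_forall fun t ht => ?_
    obtain ⟨s, hs, rfl⟩ := hf.2 t ht
    rw [← hff s hs, ← hf'.map_conj (hNE hx) (hTE hs), hff _ (conj_mem_of_mem_normalizer hx hs)]
    exact hf.1.mem (conj_mem_of_mem_normalizer hx hs)
  obtain ⟨ψ, hψ⟩ := hfN.exists_aut (hb N)
  obtain ⟨k, hk⟩ := hS ⟨α, hαS⟩
  have hk : α ^ p ^ k = 1 := congrArg Subtype.val hk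
  -- Since `α ^ p ^ k = 1` and `e ≡ 1` modulo `p ^ k`, the `p`-element `ψ ^ e` still restricts to
  -- `α` on `T`.
  obtain ⟨e, he, a, ha⟩ := exists_modEq_one_pow_pow_eq_one (Fact.out : p.Prime) ψ k
  have hαe : α ^ e = α := by
    conv_rhs => rw [← pow_one α]
    rw [pow_eq_pow_iff_modEq]
    exact he.of_dvd (orderOf_dvd_of_pow_eq_one hk)
  have hpow : ∀ n (t : T), (((ψ ^ n : F.aut N (hb N)) : MulAut N) ⟨t, hTN t.2⟩ : P) =
      ((α ^ n : F.aut T hT) : MulAut T) t := by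
    intro n
    induction n with
    | zero => intro t; simp
    | succ n ih =>
      intro t
      have : (ψ : MulAut N) ⟨t, hTN t.2⟩ = ⟨(α : MulAut T) t, hTN (Subtype.prop _)⟩ :=
        Subtype.ext (by rw [hψ, hff t t.2, hαf])
      rw [pow_succ, pow_succ, Subgroup.coe_mul, Subgroup.coe_mul, MulAut.mul_apply,
        MulAut.mul_apply, this, ih]
  obtain ⟨h, hh, hψh⟩ := exists_mIso_of_aut (ψ ^ e)
  have hhα : ∀ t : T, h t = (α : MulAut T) t := fun t => by
    have := hpow e t
    rw [hψh, hαe] at this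
    exact this
  obtain ⟨N', τ, hN', hτ⟩ := exists_fullyNormalized (hb N)
  obtain ⟨τ', hτ', hττ', hτ'τ⟩ := hτ.exists_symm
  obtain ⟨γ, hγ⟩ := ((hτ'.comp hh).comp hτ).1.exists_aut (hb N')
  have hγn : ∀ n (x : N), (((γ ^ n : F.aut N' (hb N')) : MulAut N') ⟨τ x, hτ.1.mem x.2⟩ : P) =
      τ ((((ψ ^ e) ^ n : F.aut N (hb N)) : MulAut N) x) := by
    intro n
    induction n with
    | zero => intro x; simp
    | succ n ih =>
      intro x
      have : (γ : MulAut N') ⟨τ x, hτ.1.mem x.2⟩ =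
          ⟨τ (((ψ ^ e : F.aut N (hb N)) : MulAut N) x), hτ.1.mem (Subtype.prop _)⟩ :=
        Subtype.ext ((hγ _).trans (by simp only [hψh, hττ' x x.2]))
      rw [pow_succ, Subgroup.coe_mul, MulAut.mul_apply, this, ih, pow_succ, Subgroup.coe_mul,
        MulAut.mul_apply]
  have hγp : IsPGroup p (Subgroup.zpowers γ) := by
    have hγa : γ ^ p ^ a = 1 := by
      ext ⟨y, hy⟩
      obtain ⟨x, hx, rfl⟩ := hτ.2 y hy
      simpa [ha] using hγn (p ^ a) ⟨x, hx⟩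
    obtain ⟨c, -, hc⟩ := (Nat.dvd_prime_pow Fact.out).1 (orderOf_dvd_of_pow_eq_one hγa)
    exact IsPGroup.of_card ((Nat.card_zpowers γ).trans hc)
  have hcard : Nat.card T < Nat.card N := by
    obtain ⟨x, -, hxT, hx⟩ := Subgroup.exists_mem_normalizer_notMem_of_isPGroup
      (hP.to_subgroup ⊤) hTlt
    by_contra hle
    exact hxT ((Subgroup.eq_of_le_of_card_ge hTN (not_lt.1 hle)).ge hx)
  have hcardP : Nat.card N ≤ Nat.card P := Subgroup.card_le_card_group N
  obtain ⟨β, hβ⟩ := exists_conj_mem_autP hP (hT := hb N') (fun A hA h' =>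
    ih _ (by rw [← hd, ← hτ.card_eq]; omega) N' (hb N') hN' A hA h' rfl) hγp
  obtain ⟨y, hy, hβy⟩ := mem_autP.1 (hβ γ (Subgroup.mem_zpowers γ))
  obtain ⟨b, hb', hβb⟩ := exists_mIso_of_aut β
  have hσ := hτ.comp hb'
  have hσh : ∀ x ∈ N, b (τ (h x)) = y⁻¹ * b (τ x) * y := fun x hx => by
    have h1 := hβy ((β : MulAut N') ⟨τ x, hτ.1.mem hx⟩)
    have h2 : (γ : MulAut N') ⟨τ x, hτ.1.mem hx⟩ = ⟨τ (h x), hτ.1.mem (hh.1.mem hx)⟩ :=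
      Subtype.ext (by rw [hγ, hττ' x hx])
    simp only [Subgroup.coe_mul, Subgroup.coe_inv, MulAut.mul_apply, MulAut.inv_apply_self, h2,
      hβb] at h1
    exact h1
  obtain ⟨T', hT', hσT⟩ := (hσ.1.restrict hTN (hb N') fun x hx => hσ.1.mem (hTN hx)).exists_image
  have hle : N' ≤ Subgroup.normalizer (T' : Set P) := by
    intro z hz
    obtain ⟨x, hx, rfl⟩ := hσ.2 z hz
    refine mem_normalizer_of_forall fun t ht => ?_
    obtain ⟨s, hs, rfl⟩ := hσT.2 t ht
    have := hσ.1.map_conj hx (hTN hs)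
    rw [← this]
    exact hσT.1.mem (conj_mem_of_mem_normalizer hx hs)
  -- `N'` normalizes `T'` and has the order of `N_P(T)`, the largest possible for a normalizer of a
  -- conjugate of `T`.
  have heq : N' = Subgroup.normalizer (T' : Set P) :=
    Subgroup.eq_of_le_of_card_ge hle (by
      rw [← hτ.card_eq]
      exact hTn.card_le hF hσT)
  have hyN : y ∈ N' := by
    rw [heq]
    refine mem_normalizer_of_forall fun t ht => ?_
    obtain ⟨s, hs, rfl⟩ := hσT.2 t ht
    rw [← hσh s (hTN hs), hhα ⟨s, hs⟩]
    exact hσT.1.mem (Subtype.prop _)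
  obtain ⟨z, hz, rfl⟩ := hσ.2 y hyN
  refine mem_autP.2 ⟨z, hz, fun t => ?_⟩
  rw [← hhα]
  refine hσ.1.inj (hh.1.mem (hTN t.2)) (mul_mem (mul_mem (inv_mem hz) (hTN t.2)) hz) ?_
  rw [hσ.1.map_conj hz (hTN t.2)]
  exact hσh t (hTN t.2)

/-- Transport by `f` makes `Aut_P(R)` a `p`-subgroup of `Aut_F(T)`. Some `β` conjugates it into the
Sylow subgroup `Aut_P(T)`; then `N_P(R)` lies in the extender of `f` followed by `β`. -/
theorem IsSaturated.exists_extension_normalizer [Finite P] {p : ℕ} [Fact p.Prime]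
    (hP : IsPGroup p P) (hF : F.base = ⊤) (hsat : F.IsSaturated p)
    (hTn : F.IsFullyNormalized T) (hf : F.MIso R T f) :
    ∃ g, F.Mor (Subgroup.normalizer (R : Set P)) ⊤ g ∧ F.MIso R T g := by
  have hb : ∀ U : Subgroup P, U ≤ F.base := fun U => hF ▸ le_top
  obtain ⟨f', hf', hff', hf'f⟩ := hf.exists_symm
  obtain ⟨β, hβ⟩ := exists_conj_mem_autP hP (hsat.aut_le_autP hP hF T (hb T) hTn)
    (isPGroup_autConj hP (hb T) (fun x hx => hf.1.mem hx) hf.2)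
  obtain ⟨b, hbm, hβb⟩ := exists_mIso_of_aut β
  obtain ⟨E, g, hRE, hg, hgf, hE⟩ := hsat.extend hF (hf.comp hbm) hTn
  refine ⟨g, hg.restrict (fun x hx => hE x hx ?_) hF.ge fun _ _ => Subgroup.mem_top _,
    (hf.comp hbm).1.congr hgf, fun y hy => ?_⟩
  · obtain ⟨γ, hγ⟩ := ((hf'.1.comp (mor_conj (hb R) (hb R) (hb ⊤ (Subgroup.mem_top x))
      fun g hg => conj_mem_of_mem_normalizer hx hg)).comp hf.1).exists_aut (hb T)
    have hγx : ∀ g (hg : g ∈ R), (γ : MulAut T) ⟨f g, hf.1.mem hg⟩ =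
        ⟨f (x⁻¹ * g * x), hf.1.mem (conj_mem_of_mem_normalizer hx hg)⟩ := fun g hg =>
      Subtype.ext (by rw [hγ, hff' g hg])
    obtain ⟨y, hy, hβy⟩ := mem_autP.1 (hβ γ ⟨x, hx, fun g hg => by rw [hγx g hg]⟩)
    refine ⟨y, hy, fun g hg => ?_⟩
    have h1 := hβy ((β : MulAut T) ⟨f g, hf.1.mem hg⟩)
    simp only [Subgroup.coe_mul, Subgroup.coe_inv, MulAut.mul_apply, MulAut.inv_apply_self,
      hγx g hg, hβb] at h1
    exact h1
  · obtain ⟨x, hx, rfl⟩ := (hf.comp hbm).2 y hy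
    exact ⟨x, hx, hgf x hx⟩

end Automizers

/-! ### From (iii) to (i): extending morphisms to `QR` -/

section ExtendingMorphisms

variable {P : Type*} [Group P] {F : FusionSystem P} {Q R S T : Subgroup P} {f g : P → P}

theorem IsStronglyClosed.normal (hF : F.base = ⊤) (hQ : F.IsStronglyClosed Q) : Q.Normal := by
  refine ⟨fun x hx g => ?_⟩
  have := hQ.mem (mor_conj (R := ⊤) (S := ⊤) hF.ge hF.ge (hF ▸ Subgroup.mem_top g⁻¹)
    fun _ _ => Subgroup.mem_top _) (Subgroup.mem_top x) hx
  simpa using this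

theorem IsWeaklyClosed.mem (hQ : F.IsWeaklyClosed Q) (hf : F.Mor R S f) (hQR : Q ≤ R)
    {x : P} (hx : x ∈ Q) : f x ∈ Q := by
  have hR : R ≤ F.base := by
    obtain ⟨φ, hφ, -⟩ := hf
    exact (F.le_base hφ).1
  obtain ⟨T, -, hT⟩ := ((mor_id hR hQR).comp hf).exists_image
  have := hT.1.mem hx
  rwa [hQ.2 T (isIso_iff.2 ⟨_, hT⟩)] at this

theorem IsWeaklyClosed.normal (hF : F.base = ⊤) (hQ : F.IsWeaklyClosed Q) : Q.Normal := by
  refine ⟨fun x hx g => ?_⟩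
  have := hQ.mem (mor_conj (R := ⊤) (S := ⊤) hF.ge hF.ge (hF ▸ Subgroup.mem_top g⁻¹)
    fun _ _ => Subgroup.mem_top _) le_top hx
  simpa using this

theorem IsStronglyClosed.isWeaklyClosed [Finite P] (hQ : F.IsStronglyClosed Q) :
    F.IsWeaklyClosed Q := by
  refine ⟨hQ.1, fun R hR => ?_⟩
  obtain ⟨f, hf⟩ := isIso_iff.1 hR
  refine Subgroup.eq_of_le_of_card_ge (fun y hy => ?_) hf.card_eq.le
  obtain ⟨x, hx, rfl⟩ := hf.2 y hy
  exact hQ.mem hf.1 hx hx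

/-- The morphism given by `f` on `R` extends to a morphism on `QR`. -/
def ExtendsToSup (F : FusionSystem P) (Q R : Subgroup P) (f : P → P) : Prop :=
  ∃ f', F.Mor (Q ⊔ R) ⊤ f' ∧ ∀ x ∈ R, f' x = f x

theorem ExtendsToSup.of_le (hF : F.base = ⊤) (h : F.ExtendsToSup Q S g) (hRS : R ≤ S)
    (hfg : ∀ x ∈ R, g x = f x) : F.ExtendsToSup Q R f := by
  obtain ⟨f', hf', h⟩ := h
  exact ⟨f', hf'.restrict (sup_le_sup_left hRS Q) hF.ge fun _ _ => Subgroup.mem_top _,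
    fun x hx => (h x (hRS hx)).trans (hfg x hx)⟩

theorem ExtendsToSup.exists_mIso [Finite P] (hF : F.base = ⊤) (hQ : F.IsStronglyClosed Q)
    (h : F.ExtendsToSup Q R f) (hf : F.MIso R S f) :
    ∃ f', F.MIso (Q ⊔ R) (Q ⊔ S) f' ∧ ∀ x ∈ R, f' x = f x := by
  have hb : ∀ U : Subgroup P, U ≤ F.base := fun U => hF ▸ le_top
  obtain ⟨f', hf', h⟩ := h
  have := hQ.normal hF
  have hQ' := (hf'.restrict le_sup_left hQ.1
    fun x hx => hQ.mem hf' (le_sup_left (a := Q) hx) hx).mIso_self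
  refine ⟨f', ⟨hf'.restrict le_rfl (hb _) fun x hx => ?_, fun y hy => ?_⟩, h⟩
  · obtain ⟨q, hq, r, hr, rfl⟩ := Subgroup.mem_sup_of_normal_left.1 hx
    rw [hf'.map_mul (le_sup_left (a := Q) hq) (le_sup_right (a := Q) hr), h r hr]
    exact Subgroup.mul_mem_sup (hQ'.1.mem hq) (hf.1.mem hr)
  · obtain ⟨q, hq, s, hs, rfl⟩ := Subgroup.mem_sup_of_normal_left.1 hy
    obtain ⟨q', hq', rfl⟩ := hQ'.2 q hq
    obtain ⟨r, hr, rfl⟩ := hf.2 s hs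
    exact ⟨q' * r, Subgroup.mul_mem_sup hq' hr, by
      rw [hf'.map_mul (le_sup_left (a := Q) hq') (le_sup_right (a := Q) hr), h r hr]⟩

/-- An isomorphism `R → T` extends to each `c` centralizing `R`, with `y = 1`. The image of `c`
centralizes `T`, hence lies in `T`, and injectivity gives `c ∈ R`. -/
theorem isCentric_of_centralizer_le [Finite P] {p : ℕ} (hF : F.base = ⊤) (hsat : F.IsSaturated p)
    (hTn : F.IsFullyNormalized T) (h : Subgroup.centralizer (T : Set P) ≤ T) :
    F.IsCentric T := by
  refine ⟨hTn.1, fun R hR c hc => ?_⟩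
  obtain ⟨f, hf⟩ := isIso_iff.1 hR
  obtain ⟨g, hg, hgf, hfg⟩ := hf.exists_symm
  obtain ⟨E, g', hRE, hg', hgg, hE⟩ := hsat.extend hF hg hTn
  have hcR : ∀ x ∈ R, c⁻¹ * x * c = x := fun x hx => by
    rw [mul_assoc, Subgroup.mem_centralizer_iff.1 hc.2 x hx, inv_mul_cancel_left]
  have hcE : c ∈ E := hE c (mem_normalizer_of_forall fun x hx => by
    rwa [hcR x hx]) ⟨1, one_mem _, fun x hx => by
      rw [hcR x hx]
      simp⟩
  have hcT : g' c ∈ T := h (Subgroup.mem_centralizer_iff.2 fun t ht => by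
    obtain ⟨x, hx, rfl⟩ := hg.2 t ht
    rw [← hgg x hx, ← hg'.map_mul (hRE hx) hcE, ← hg'.map_mul hcE (hRE hx),
      Subgroup.mem_centralizer_iff.1 hc.2 x hx])
  obtain ⟨x, hx, hxc⟩ := hg.2 _ hcT
  rw [← hgg x hx] at hxc
  exact hg'.inj (hRE hx) hcE hxc ▸ hx

instance inn_normal : (inn R).Normal := by
  refine ⟨?_⟩
  rintro _ ⟨x, rfl⟩ β
  exact ⟨β x, by ext y; simp⟩

theorem exists_normal_of_not_isRadical {p : ℕ} (hP : IsPGroup p P) (hT : T ≤ F.base)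
    (h : ¬ F.IsRadical p T) : ∃ N : Subgroup (F.aut T hT), N.Normal ∧ IsPGroup p N ∧
      ¬ N ≤ (inn T).subgroupOf (F.aut T hT) := by
  by_contra! hcon
  exact h ⟨hT, le_antisymm (sSup_le fun N hN => hcon N hN.1 hN.2)
    (le_sSup ⟨inferInstance, (isPGroup_autP hP hT).to_le (subgroupOf_inn_le_autP hT)⟩)⟩

/-- If `Q` is strongly closed and contained in each fully normalized, centric, radical subgroup,
then each morphism `R → P` extends to `QR`. -/
theorem IsSaturated.extendsToSup [Finite P] {p : ℕ} [Fact p.Prime] (hP : IsPGroup p P)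
    (hF : F.base = ⊤) (hsat : F.IsSaturated p) (hQ : F.IsStronglyClosed Q)
    (hQT : ∀ T : Subgroup P, F.IsFullyNormalized T → F.IsCentric T → F.IsRadical p T → Q ≤ T)
    (R : Subgroup P) (f : P → P) (hf : F.Mor R ⊤ f) : F.ExtendsToSup Q R f := by
  induction hd : Nat.card P - Nat.card R using Nat.strong_induction_on generalizing R f with
  | _ d ih =>
  by_cases hQR : Q ≤ R
  · exact ⟨f, by rwa [sup_eq_right.2 hQR], fun _ _ => rfl⟩
  have hb : ∀ U : Subgroup P, U ≤ F.base := fun U => hF ▸ le_top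
  have hRlt : R < ⊤ := lt_top_iff_ne_top.2 fun h => hQR (h ▸ le_top)
  -- Induction reduces the goal to an extension to any strictly larger subgroup, for all domains of
  -- the order of `R`.
  have ih' : ∀ (R' E : Subgroup P) (f g : P → P), Nat.card R' = Nat.card R → R' ≤ E →
      (∃ x ∈ E, x ∉ R') → F.Mor E ⊤ g → (∀ x ∈ R', g x = f x) → F.ExtendsToSup Q R' f := by
    rintro R' E f g hc hle ⟨x, hxE, hxR⟩ hg hgf
    have hlt : Nat.card R' < Nat.card E := by
      by_contra h
      exact hxR ((Subgroup.eq_of_le_of_card_ge hle (not_lt.1 h)).ge hxE)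
    have hE : Nat.card E ≤ Nat.card P := Subgroup.card_le_card_group E
    exact (ih _ (by omega) E g hg rfl).of_le hF hle hgf
  obtain ⟨S, -, hfS⟩ := hf.exists_image
  obtain ⟨T, t, hTn, ht⟩ := exists_fullyNormalized (hb R)
  obtain ⟨f₁, hf₁, hff₁, hf₁f⟩ := hfS.exists_symm
  have hlarge : ∀ (R' : Subgroup P) (f : P → P), F.MIso R' T f →
      ∃ k, F.MIso R' T k ∧ F.ExtendsToSup Q R' k := by
    intro R' f hR'
    obtain ⟨k, hk, hkT⟩ := hsat.exists_extension_normalizer hP hF hTn hR'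
    have hc : Nat.card R' = Nat.card R := hR'.card_eq.trans ht.card_eq.symm
    have hlt : R' < ⊤ := by
      refine lt_top_iff_ne_top.2 fun h => hRlt.ne ?_
      refine Subgroup.eq_of_le_of_card_ge le_top ?_
      rw [← hc, h]
    obtain ⟨x, -, hxR, hx⟩ := Subgroup.exists_mem_normalizer_notMem_of_isPGroup
      (hP.to_subgroup ⊤) hlt
    exact ⟨k, hkT, ih' R' _ k k hc Subgroup.le_normalizer ⟨x, hx, hxR⟩ hk fun _ _ => rfl⟩
  obtain ⟨k, hk, hkQ⟩ := hlarge R t ht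
  obtain ⟨l, hl, hlQ⟩ := hlarge S _ (hf₁.comp ht)
  obtain ⟨k₁, hk₁, hkk₁, hk₁k⟩ := hk.exists_symm
  -- On `R`, `f` is `k`, then this automorphism, then the inverse of `l`; as `k` and `l` extend,
  -- only the automorphism is left.
  have hα : F.MIso T T (fun x => l (f (k₁ x))) := (hk₁.comp hfS).comp hl
  have hαQ : F.ExtendsToSup Q T (fun x => l (f (k₁ x))) := by
    set α := fun x => l (f (k₁ x))
    have hstep : ∀ x ∈ Subgroup.normalizer (T : Set P), x ∉ T →
        ∀ y ∈ Subgroup.normalizer (T : Set P),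
        (∀ g ∈ T, α (x⁻¹ * g * x) = y⁻¹ * α g * y) → F.ExtendsToSup Q T α := by
      intro x hx hxT y hy hxy
      obtain ⟨E, g, hTE, hg, hgα, hE⟩ := hsat.extend hF hα hTn
      exact ih' T E α g ht.card_eq.symm hTE ⟨x, hE x hx ⟨y, hy, hxy⟩, hxT⟩ hg hgα
    by_cases hc : Subgroup.centralizer (T : Set P) ≤ T
    · by_cases hr : F.IsRadical p T
      · refine ⟨α, ?_, fun _ _ => rfl⟩
        rw [sup_eq_right.2 (hQT T hTn (isCentric_of_centralizer_le hF hsat hTn hc) hr)]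
        exact hα.1.restrict le_rfl hF.ge fun _ _ => Subgroup.mem_top _
      · obtain ⟨N, hN, hNp, hNinn⟩ := exists_normal_of_not_isRadical hP (hb T) hr
        -- A normal `p`-subgroup lies in every Sylow subgroup. So a non-inner `κ ∈ N` and its
        -- conjugate by `α` are both induced by elements of `N_P(T)`, which puts an element outside
        -- `T` into `N_α`.
        have hNP : ∀ κ ∈ N, κ ∈ F.autP T (hb T) := fun κ hκ => by
          obtain ⟨β, hβ⟩ := exists_conj_mem_autP hP (hsat.aut_le_autP hP hF T (hb T) hTn) hNp
          have := hβ _ (hN.conj_mem κ hκ β⁻¹)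
          simpa [mul_assoc] using this
        obtain ⟨κ, hκ, hκinn⟩ := SetLike.not_le_iff_exists.1 hNinn
        obtain ⟨x, hx, hκx⟩ := mem_autP.1 (hNP κ hκ)
        obtain ⟨a, ha⟩ := hα.1.exists_aut (hb T)
        obtain ⟨y, hy, hκy⟩ := mem_autP.1 (hNP _ (hN.conj_mem κ hκ a))
        refine hstep x hx (fun hxT => hκinn (mem_inn_of_forall hxT hκx)) y hy fun g hg => ?_
        have h1 := hκy ((a : MulAut T) ⟨g, hg⟩)
        have h2 : (κ : MulAut T) ⟨g, hg⟩ = ⟨x⁻¹ * g * x, conj_mem_of_mem_normalizer hx hg⟩ :=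
          Subtype.ext (hκx _)
        simp only [Subgroup.coe_mul, Subgroup.coe_inv, MulAut.mul_apply, MulAut.inv_apply_self,
          h2, ha] at h1
        exact h1
    · obtain ⟨c, hc, hcT⟩ := SetLike.not_le_iff_exists.1 hc
      have hcx : ∀ x ∈ T, c⁻¹ * x * c = x := fun x hx => by
        rw [mul_assoc, Subgroup.mem_centralizer_iff.1 hc x hx, inv_mul_cancel_left]
      refine hstep c (mem_normalizer_of_forall fun x hx => by rwa [hcx x hx]) hcT 1 (one_mem _)
        fun x hx => ?_
      rw [hcx x hx]
      simp
  obtain ⟨k', hk', hkk'⟩ := hkQ.exists_mIso hF hQ hk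
  obtain ⟨l', hl', hll'⟩ := hlQ.exists_mIso hF hQ hl
  obtain ⟨α', hα', hαα'⟩ := hαQ.exists_mIso hF hQ hα
  obtain ⟨m, hm, hml, -⟩ := hl'.exists_symm
  refine ⟨fun x => m (α' (k' x)), ((hk'.comp hα').comp hm).1.restrict le_rfl hF.ge
    fun _ _ => Subgroup.mem_top _, fun x hx => ?_⟩
  have hfx := hfS.1.mem hx
  simp only
  rw [hkk' x hx, hαα' _ (hk.1.mem hx), hkk₁ x hx, ← hll' _ hfx, hml _ (le_sup_right (a := Q) hfx)]

theorem eq_normalizer_of_extendsToSup [Finite P] (hF : F.base = ⊤) (hQ : F.IsStronglyClosed Q)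
    (h : ∀ R f, F.Mor R ⊤ f → F.ExtendsToSup Q R f) : F = F.normalizer Q hQ.1 := by
  have hb : ∀ U : Subgroup P, U ≤ F.base := fun U => hF ▸ le_top
  have hN : F.baseNormalizer Q = ⊤ := by
    have := hQ.normal hF
    rw [baseNormalizer, hF, top_inf_eq, Subgroup.normalizer_eq_top]
  refine FusionSystem.ext (hF.trans hN.symm) ?_
  funext R S
  refine Set.Subset.antisymm (fun φ hφ => ?_) fun φ hφ => hφ.2.2.1
  refine ⟨hN ▸ le_top, hN ▸ le_top, hφ, ?_⟩
  obtain ⟨f, hf, hφf⟩ := exists_mor hφ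
  obtain ⟨T, hTS, hT⟩ := hf.exists_image
  obtain ⟨f', hf', hff'⟩ := (h R f (hf.restrict le_rfl hF.ge fun _ _ =>
    Subgroup.mem_top _)).exists_mIso hF hQ hT
  obtain ⟨φ', hφ', hφf'⟩ := hf'.1.restrict le_rfl (hb _)
    fun x hx => sup_le_sup_left hTS Q (hf'.1.mem hx)
  obtain ⟨α, hα⟩ := (hf'.1.restrict le_sup_left hQ.1
    fun x hx => hQ.mem hf'.1 (le_sup_left (a := Q) hx) hx).exists_aut hQ.1
  refine ⟨φ', hφ', ⟨le_sup_right, fun x => ?_⟩, α, fun x => ?_⟩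
  · rw [hφf', hφf]
    exact hff' x x.2
  · rw [hφf', hα]
    rfl

end ExtendingMorphisms

/-! ### Consequences of (i), and tools for radical subgroups -/

section NormalSubsystem

variable {P : Type*} [Group P] {F : FusionSystem P} {Q R S T : Subgroup P} {f g : P → P}

theorem exists_extension_of_eq_normalizer {hQ : Q ≤ F.base} (h : F = F.normalizer Q hQ)
    (hF : F.base = ⊤) (hf : F.Mor R ⊤ f) :
    ∃ (f' : P → P) (α : MulAut Q), F.Mor (Q ⊔ R) ⊤ f' ∧ (∀ x ∈ R, f' x = f x) ∧
      ∀ x : Q, f' x = α x := by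
  obtain ⟨φ, hφ, hφf⟩ := hf
  have hH : F.Hom R ⊤ = (F.normalizer Q hQ).Hom R ⊤ := by
    rw [← h]
  obtain ⟨-, -, -, φ', hφ', ⟨hle, hext⟩, α, hα⟩ : φ ∈ (F.normalizer Q hQ).Hom R ⊤ := hH ▸ hφ
  obtain ⟨f', hf', hff'⟩ := exists_mor hφ'
  refine ⟨f', α, hf'.restrict le_rfl hF.ge fun _ _ => Subgroup.mem_top _, fun x hx => ?_,
    fun x => ?_⟩
  · rw [← hφf ⟨x, hx⟩, ← hext, hff']
    rfl
  · rw [← hα, hff']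
    rfl

theorem isStronglyClosed_of_eq_normalizer {hQ : Q ≤ F.base} (h : F = F.normalizer Q hQ)
    (hF : F.base = ⊤) (C : Subgroup Q) [C.Characteristic] :
    F.IsStronglyClosed (C.map Q.subtype) := by
  refine ⟨hF ▸ le_top, fun R S hR φ hφ x => ?_⟩
  obtain ⟨f, hf, hφf⟩ := exists_mor hφ
  obtain ⟨f', α, -, hff', hα⟩ := exists_extension_of_eq_normalizer h hF
    (hf.restrict le_rfl hF.ge fun _ _ => Subgroup.mem_top _)
  obtain ⟨c, hc, hcx⟩ := hR x.2
  refine ⟨α c, ?_, ?_⟩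
  · have := Subgroup.characteristic_iff_le_comap.1 ‹C.Characteristic› α hc
    exact this
  · rw [hφf, ← hff' x x.2, ← hcx]
    exact (hα c).symm

theorem le_extender (φ : R →* S) (hR : R ≤ F.base) (hS : S ≤ F.base) : R ≤ F.extender φ := by
  intro x hx
  refine ⟨⟨hR hx, Subgroup.le_normalizer hx⟩, φ ⟨x, hx⟩,
    ⟨hS (φ _).2, Subgroup.le_normalizer ⟨⟨x, hx⟩, rfl⟩⟩, fun g g' hg => ?_⟩
  have : g' = ⟨x, hx⟩⁻¹ * g * ⟨x, hx⟩ := Subtype.ext hg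
  simp [this]

theorem inner_isSaturated {p : ℕ} (hP : IsPGroup p P) (Q : Subgroup P) :
    (inner Q).IsSaturated p := by
  constructor
  · have htop : (inn Q).subgroupOf ((inner Q).aut Q le_rfl) = ⊤ := by
      refine top_le_iff.1 fun α _ => ?_
      obtain ⟨-, -, g, hg, h⟩ := α.2
      exact mem_inn_of_forall hg h
    refine ⟨⟨(inn Q).subgroupOf ((inner Q).aut Q le_rfl),
      (isPGroup_autP hP (F := inner Q) le_rfl).to_le (subgroupOf_inn_le_autP _),
      fun {K} _ hK => ?_⟩, rfl⟩
    rw [htop] at hK ⊢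
    exact top_le_iff.1 hK
  · rintro R φ ⟨hR, -, g, hg, h⟩ -
    have hE : (inner Q).extender φ ≤ (inner Q).base := fun x hx => hx.1.1
    obtain ⟨φ', hφ', hφg⟩ := mor_conj (F := inner Q) hE le_rfl (g := g) hg
      fun x hx => mul_mem (mul_mem (inv_mem hg) (hE hx)) hg
    exact ⟨φ', hφ', le_extender φ hR le_rfl, fun x => by
      rw [hφg, h]
      rfl⟩

theorem inner_isNormalIn_of_eq_normalizer {p : ℕ} (hP : IsPGroup p P) {hQ : Q ≤ F.base}
    (h : F = F.normalizer Q hQ) (hF : F.base = ⊤) : (inner Q).IsNormalIn p F := by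
  have hQs : F.IsStronglyClosed Q := by
    have := isStronglyClosed_of_eq_normalizer h hF (⊤ : Subgroup Q)
    rwa [← MonoidHom.range_eq_map, Subgroup.range_subtype] at this
  refine ⟨⟨⟨hQ, fun R S φ ⟨hR, hS, g, hg, hφ⟩ =>
    F.conj_mem (hR.trans hQ) (hS.trans hQ) g (hQ hg) φ hφ⟩, hQs, ?_⟩, inner_isSaturated hP Q⟩
  rintro R S hRS hSQ φ ⟨-, -, g, hg, hφ⟩ ψ hψ
  obtain ⟨f, hf, hψf⟩ := exists_mor hψ
  obtain ⟨f', α, hf', hff', hα⟩ := exists_extension_of_eq_normalizer h hF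
    (hf.restrict le_rfl hF.ge fun _ _ => Subgroup.mem_top _)
  have hgQ : f' g ∈ Q := by
    rw [hα ⟨g, hg⟩]
    exact (α _).2
  have hrange : ((F.base.subtype.comp ψ).comp (Subgroup.inclusion hRS)).range ≤ Q := by
    rintro _ ⟨x, rfl⟩
    exact hQs.2 S F.base hSQ ψ hψ _
  obtain ⟨χ, hχ, hχg⟩ := mor_conj (F := inner Q) hrange le_rfl (g := f' g) hgQ
    fun x hx => mul_mem (mul_mem (inv_mem hgQ) (hrange hx)) hgQ
  refine ⟨χ, hχ, fun x => ?_⟩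
  rw [hχg, hψf, ← hff' _ (φ x).2, hφ,
    hf'.map_conj (le_sup_left (a := Q) hg) (le_sup_right (a := Q) (hRS x.2)), hff' _ (hRS x.2)]
  have : ψ (Subgroup.inclusion hRS x) = f x := hψf _
  rw [← this]
  rfl

/-- Invariance says that `f` transports conjugation by an element of `Q` to such a conjugation; this
makes `innerOnInf` normal. -/
theorem IsInvariant.exists_conj (hF : F.base = ⊤) (h : (inner Q).IsInvariant F) (hR : R ≤ Q)
    {q : P} (hq : q ∈ Q) (hqR : ∀ x ∈ R, q⁻¹ * x * q ∈ R) (hf : F.Mor R ⊤ f) :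
    ∃ q' ∈ Q, ∀ x ∈ R, f (q⁻¹ * x * q) = q'⁻¹ * f x * q' := by
  obtain ⟨φ, hφ, hφq⟩ := mor_conj (F := inner Q) hR hR hq hqR
  obtain ⟨ψ, hψ, hψf⟩ := hf.restrict le_rfl (le_refl F.base) fun x _ => hF ▸ Subgroup.mem_top _
  obtain ⟨χ, ⟨-, -, q', hq', hχ⟩, hχψ⟩ := h.2.2 R R le_rfl hR φ hφ ψ hψ
  refine ⟨q', hq', fun x hx => ?_⟩
  have h1 := hχψ ⟨x, hx⟩
  rw [hχ, hψf, hφq] at h1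
  have h2 : ψ ⟨x, hx⟩ = f x := hψf ⟨x, hx⟩
  rw [← h1, ← h2]
  rfl

/-- Radicality makes `α` inner, say `t ↦ q * t * q⁻¹` with `q ∈ T`. Then `x * q` centralizes `T`, so
it lies in `T` by centricity. -/
theorem IsRadical.mem_of_aut_mem {p : ℕ} {hT : T ≤ F.base} (hF : F.base = ⊤)
    (hc : F.IsCentric T) (hr : F.IsRadical p T) {N : Subgroup (F.aut T hT)} (hN : N.Normal)
    (hNp : IsPGroup p N) {α : F.aut T hT} (hα : α ∈ N) {x : P}
    (hx : ∀ t : T, ((α : MulAut T) t : P) = x⁻¹ * t * x) : x ∈ T := by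
  obtain ⟨_, hr⟩ := hr
  have hNle : N ≤ pCore p (F.aut T hT) := le_sSup ⟨hN, hNp⟩
  obtain ⟨q, hq⟩ := hr ▸ hNle hα
  have hxq : x * q ∈ T := by
    refine hc.2 T (isIso_iff.2 ⟨_, MIso.refl hT⟩) ⟨hF ▸ Subgroup.mem_top _, ?_⟩
    refine Subgroup.mem_centralizer_iff.2 fun t ht => ?_
    have h1 := hx ⟨t, ht⟩
    have h2 : (α : MulAut T) = MulAut.conj q := hq.symm
    rw [h2] at h1
    simp only [MulAut.conj_apply, Subgroup.coe_mul, Subgroup.coe_inv] at h1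
    have h3 : x * (q * t * (q : P)⁻¹) * q = x * (x⁻¹ * t * x) * q := by rw [h1]
    simpa [mul_assoc] using h3.symm
  simpa using mul_mem hxq (inv_mem q.2)

/-- Otherwise `T` is proper in `AT`, so some `a * t` outside `T` normalizes `T`, and then so does
`a`. -/
theorem le_of_forall_mem_normalizer [Finite P] {p : ℕ} [Fact p.Prime] (hP : IsPGroup p P)
    {A : Subgroup P} [A.Normal] (h : ∀ x ∈ A, x ∈ Subgroup.normalizer (T : Set P) → x ∈ T) :
    A ≤ T := by
  by_contra hle
  obtain ⟨x, hx, hxT, hxn⟩ := Subgroup.exists_mem_normalizer_notMem_of_isPGroup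
    (hP.to_subgroup (A ⊔ T)) (right_lt_sup.2 hle)
  obtain ⟨a, ha, t, ht, rfl⟩ := Subgroup.mem_sup_of_normal_left.1 hx
  refine hxT (mul_mem (h a ha ?_) ht)
  simpa using mul_mem hxn (inv_mem (Subgroup.le_normalizer ht))

/-- The subgroup `A` of `P` is invariant under `Aut_F(T)`, in the sense that `A ∩ T` is. -/
def AutInvariant (F : FusionSystem P) (T : Subgroup P) (hT : T ≤ F.base) (A : Subgroup P) : Prop :=
  ∀ (α : F.aut T hT) (t : T), (t : P) ∈ A → ((α : MulAut T) t : P) ∈ A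

theorem IsStronglyClosed.autInvariant (hQ : F.IsStronglyClosed Q) (hT : T ≤ F.base) :
    F.AutInvariant T hT Q := fun α t ht => by
  obtain ⟨f, hf, hαf⟩ := exists_mIso_of_aut α
  rw [hαf]
  exact hQ.mem hf.1 t.2 ht

theorem IsWeaklyClosed.autInvariant (hQ : F.IsWeaklyClosed Q) (hT : T ≤ F.base) (hQT : Q ≤ T) :
    F.AutInvariant T hT Q := fun α t ht => by
  obtain ⟨f, hf, hαf⟩ := exists_mIso_of_aut α
  rw [hαf]
  exact hQ.mem hf.1 hQT ht

/-- The automorphisms in `Aut_F(T)` that stabilize the chain of intersections of `T` with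
`D 0, …, D m`. -/
def chainStabilizer (F : FusionSystem P) (T : Subgroup P) (hT : T ≤ F.base)
    (D : ℕ → Subgroup P) (m : ℕ) (hD : ∀ j, F.AutInvariant T hT (D j)) :
    Subgroup (F.aut T hT) where
  carrier := {β | ∀ j < m, ∀ t : T, (t : P) ∈ D (j + 1) →
    (t : P)⁻¹ * ((β : MulAut T) t : P) ∈ D j}
  one_mem' := fun j _ t _ => by simp
  mul_mem' := by
    intro a b ha hb j hj t ht
    have h1 := hD j a (t⁻¹ * (b : MulAut T) t) (hb j hj t ht)
    have h2 := mul_mem (ha j hj t ht) h1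
    simpa [mul_assoc] using h2
  inv_mem' := by
    intro a ha j hj t ht
    have h1 := hD j a⁻¹ (t⁻¹ * (a : MulAut T) t) (ha j hj t ht)
    have h2 := inv_mem h1
    simpa [mul_assoc] using h2

theorem chainStabilizer_normal {hT : T ≤ F.base} {D : ℕ → Subgroup P} {m : ℕ}
    (hD : ∀ j, F.AutInvariant T hT (D j)) : (F.chainStabilizer T hT D m hD).Normal := by
  refine ⟨fun β hβ α j hj t ht => ?_⟩
  have h1 := hD j α
    ((((α⁻¹ : F.aut T hT) : MulAut T) t)⁻¹ * (β : MulAut T) (((α⁻¹ : F.aut T hT) : MulAut T) t))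
    (hβ j hj _ (hD _ α⁻¹ t ht))
  simpa [mul_assoc] using h1

end NormalSubsystem

/-! ### From (ii) or (v) to (iii): normal `p`-subgroups of `Aut_F(T)` that stabilize chains -/

section ChainStabilizers

variable {P : Type*} [Group P] {F : FusionSystem P} {Q R S T : Subgroup P} {f g : P → P}

/-- If `γ = β ^ p ^ k` fixes `A ∩ T` and `γ t = t * c` with `c ∈ A`, then `γ ^ n` sends `t` to `t *
c ^ n`; a power of `p` bounding the exponent of `P` finishes. -/
theorem exists_pow_fix_of_mul_mem {p : ℕ} (hP : IsPGroup p P) [Finite P] {β : MulAut T}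
    {A B : Subgroup P} (hA : ∀ t : T, (t : P) ∈ A → (β t : P) ∈ A)
    (hAB : ∀ t : T, (t : P) ∈ B → (t : P)⁻¹ * (β t : P) ∈ A)
    (hfix : ∃ k, ∀ t : T, (t : P) ∈ A → (β ^ p ^ k) t = t) :
    ∃ k, ∀ t : T, (t : P) ∈ B → (β ^ p ^ k) t = t := by
  obtain ⟨k, hk⟩ := hfix
  obtain ⟨m, hm⟩ := hP.exists_exponent_dvd_pow
  refine ⟨k + m, fun t ht => ?_⟩
  have hmem : ∀ n : ℕ, (t : P)⁻¹ * ((β ^ n) t : P) ∈ A := by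
    intro n
    induction n with
    | zero => simp
    | succ n ih =>
      have h1 := mul_mem (hAB t ht) (hA (t⁻¹ * (β ^ n) t) ih)
      rw [pow_succ', MulAut.mul_apply]
      simpa [mul_assoc] using h1
  set γ := β ^ p ^ k with hγ
  obtain ⟨c, hc⟩ : ∃ c, c = t⁻¹ * γ t := ⟨_, rfl⟩
  have hcA : (c : P) ∈ A := by
    rw [hc]
    exact hmem _
  have hpow : ∀ n : ℕ, (γ ^ n) t = t * c ^ n := by
    intro n
    induction n with
    | zero => simp
    | succ n ih =>
      have : γ t = t * c := by simp [hc]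
      rw [pow_succ', MulAut.mul_apply, ih, map_mul, map_pow, hk c hcA, this, pow_succ', mul_assoc]
  rw [pow_add, pow_mul, ← hγ, hpow]
  have hcm : c ^ p ^ m = 1 := Subtype.ext (by
    simpa using orderOf_dvd_iff_pow_eq_one.1 ((Monoid.order_dvd_exponent (c : P)).trans hm))
  rw [hcm, mul_one]

theorem exists_pow_fix_of_mem_chainStabilizer [Finite P] {p : ℕ} (hP : IsPGroup p P)
    {hT : T ≤ F.base} {D : ℕ → Subgroup P} {m : ℕ} {hD : ∀ j, F.AutInvariant T hT (D j)}
    {β : F.aut T hT} (hβ : β ∈ F.chainStabilizer T hT D m hD)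
    (h0 : ∃ k, ∀ t : T, (t : P) ∈ D 0 → ((β : MulAut T) ^ p ^ k) t = t) :
    ∃ k, ∀ t : T, (t : P) ∈ D m → ((β : MulAut T) ^ p ^ k) t = t := by
  have key : ∀ j ≤ m, ∃ k, ∀ t : T, (t : P) ∈ D j → ((β : MulAut T) ^ p ^ k) t = t := by
    intro j
    induction j with
    | zero => exact fun _ => h0
    | succ j ih =>
      exact fun hj => exists_pow_fix_of_mul_mem hP (hD j β) (hβ j hj) (ih (by omega))
  exact key m le_rfl

theorem isPGroup_of_forall_exists_pow_fix {p : ℕ} {hT : T ≤ F.base} {N : Subgroup (F.aut T hT)}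
    (h : ∀ β ∈ N, ∃ k, ∀ t : T, ((β : MulAut T) ^ p ^ k) t = t) : IsPGroup p N := by
  rintro ⟨β, hβ⟩
  obtain ⟨k, hk⟩ := h β hβ
  refine ⟨k, ?_⟩
  ext t
  simp [hk]

/-- The automorphisms in `Aut_F(T)` that agree on `T ∩ Q` with an inner automorphism of `Q`. -/
def innerOnInf (F : FusionSystem P) (Q T : Subgroup P) (hT : T ≤ F.base)
    (hQ : F.AutInvariant T hT Q) : Subgroup (F.aut T hT) where
  carrier := {β | ∃ q ∈ Q, ∀ t : T, (t : P) ∈ Q → ((β : MulAut T) t : P) = q⁻¹ * t * q}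
  one_mem' := ⟨1, one_mem _, fun t _ => by simp⟩
  mul_mem' := by
    rintro a b ⟨q, hq, ha⟩ ⟨r, hr, hb⟩
    refine ⟨r * q, mul_mem hr hq, fun t ht => ?_⟩
    rw [Subgroup.coe_mul, MulAut.mul_apply, ha _ (hQ b t ht), hb t ht]
    simp [mul_assoc]
  inv_mem' := by
    rintro a ⟨q, hq, ha⟩
    refine ⟨q⁻¹, inv_mem hq, fun t ht => ?_⟩
    have h1 := ha _ (hQ a⁻¹ t ht)
    rw [Subgroup.coe_inv, MulAut.apply_inv_self] at h1
    rw [h1]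
    simp [mul_assoc]

theorem innerOnInf_normal (hF : F.base = ⊤) (hinv : (inner Q).IsInvariant F) (hT : T ≤ F.base) :
    (F.innerOnInf Q T hT (hinv.2.1.autInvariant hT)).Normal := by
  have hQ := hinv.2.1.autInvariant hT
  refine ⟨fun β ⟨q, hq, hβ⟩ α => ?_⟩
  obtain ⟨f, hf, hαf⟩ := exists_mIso_of_aut α
  obtain ⟨r, hr, hfr⟩ := hinv.exists_conj (R := T ⊓ Q) hF inf_le_right hq
    (fun x hx => by
      rw [← hβ ⟨x, hx.1⟩ hx.2]
      exact ⟨Subtype.prop _, hQ β _ hx.2⟩)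
    (hf.1.restrict inf_le_left hF.ge fun _ _ => Subgroup.mem_top _)
  refine ⟨r, hr, fun t ht => ?_⟩
  have h1 := hfr _ ⟨Subtype.prop (((α⁻¹ : F.aut T hT) : MulAut T) t), hQ α⁻¹ t ht⟩
  rw [← hβ _ (hQ α⁻¹ t ht), ← hαf, ← hαf, Subgroup.coe_inv, MulAut.apply_inv_self] at h1
  exact h1

theorem exists_pow_fix_of_mem_innerOnInf {p : ℕ} (hP : IsPGroup p P) {hT : T ≤ F.base}
    {hQ : F.AutInvariant T hT Q} {β : F.aut T hT} (hβ : β ∈ F.innerOnInf Q T hT hQ) :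
    ∃ k, ∀ t : T, (t : P) ∈ Q → ((β : MulAut T) ^ p ^ k) t = t := by
  obtain ⟨q, -, hβ⟩ := hβ
  obtain ⟨k, hk⟩ := hP q
  have key : ∀ n : ℕ, ∀ t : T, (t : P) ∈ Q →
      (((β : MulAut T) ^ n) t : P) = (q ^ n)⁻¹ * t * q ^ n := by
    intro n
    induction n with
    | zero => intro t _; simp
    | succ n ih =>
      intro t ht
      rw [pow_succ, MulAut.mul_apply, ih _ (hQ β t ht), hβ t ht, pow_succ']
      simp [mul_assoc]
  exact ⟨k, fun t ht => Subtype.ext (by simp [key _ t ht, hk])⟩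

/-- Automorphisms of `T` that are trivial on `T/(T ∩ Q)` and agree on `T ∩ Q` with conjugation by an
element of `Q` form a normal `p`-subgroup. It contains those induced by `N_Q(T)`, because `Q` is
normal in `P`. -/
theorem le_of_inner_isInvariant [Finite P] {p : ℕ} [Fact p.Prime] (hP : IsPGroup p P)
    (hF : F.base = ⊤) (hinv : (inner Q).IsInvariant F) (hc : F.IsCentric T)
    (hr : F.IsRadical p T) : Q ≤ T := by
  have hT := hc.1
  have hQ : F.AutInvariant T hT Q := hinv.2.1.autInvariant hT
  have hn : Q.Normal := hinv.2.1.normal hF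
  let D : ℕ → Subgroup P := fun j => if j = 0 then Q else ⊤
  have hD : ∀ j, F.AutInvariant T hT (D j) := by
    intro j
    by_cases hj : j = 0
    · simpa [D, hj] using hQ
    · exact fun _ _ _ => by simp [D, hj]
  have hn₁ := innerOnInf_normal hF hinv hT
  have hn₂ := chainStabilizer_normal (m := 1) hD
  refine le_of_forall_mem_normalizer hP fun x hxQ hx => ?_
  obtain ⟨α, -, hα⟩ := exists_aut_conj hF hT hx
  refine hr.mem_of_aut_mem hF hc (N := F.innerOnInf Q T hT hQ ⊓ F.chainStabilizer T hT D 1 hD)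
    inferInstance (isPGroup_of_forall_exists_pow_fix fun β hβ => ?_)
    (α := α) ⟨⟨x, hxQ, fun t _ => hα t⟩, fun j hj t _ => ?_⟩ hα
  · obtain ⟨k, hk⟩ := exists_pow_fix_of_mem_chainStabilizer hP hβ.2 (by
      simpa [D] using exists_pow_fix_of_mem_innerOnInf hP hβ.1)
    exact ⟨k, fun t => hk t (by simp [D])⟩
  · obtain rfl : j = 0 := by omega
    rw [hα]
    have := mul_mem (hn.conj_mem _ (inv_mem hxQ) (t : P)⁻¹) hxQ
    simpa [D, mul_assoc] using this

theorem IsCentralSeries.le {n : ℕ} {C : ℕ → Subgroup P} (hC : IsCentralSeries Q n C) {i j : ℕ}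
    (hij : i ≤ j) (hj : j ≤ n) : C i ≤ C j := by
  induction j, hij using Nat.le_induction with
  | base => exact le_rfl
  | succ j _ ih => exact (ih (by omega)).trans (hC.2.2 j hj).1

/-- The terms `C i` are put into `T` one at a time. Weak closure makes `C j` invariant under
`Aut_F(T)` only once `C j ≤ T`, whereas `Q ∩ T` is always invariant as `Q` is strongly closed. -/
theorem le_of_isCentralSeries [Finite P] {p : ℕ} [Fact p.Prime] (hP : IsPGroup p P)
    (hF : F.base = ⊤) (hQ : F.IsStronglyClosed Q) {n : ℕ} {C : ℕ → Subgroup P}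
    (hC : IsCentralSeries Q n C) (hCw : ∀ i ≤ n, F.IsWeaklyClosed (C i)) (hc : F.IsCentric T)
    (hr : F.IsRadical p T) : Q ≤ T := by
  have hT := hc.1
  have hQn := hQ.normal hF
  have key : ∀ i ≤ n, C i ≤ T := by
    intro i
    induction i with
    | zero => exact fun _ => hC.1.le.trans bot_le
    | succ i ih =>
    intro hi
    have hiT := ih (by omega)
    have := (hCw _ hi).normal hF
    -- The chain skips from `C i` to `Q`: an `x ∈ C (i + 1)` is trivial on that step because `[C (i
    -- + 1), Q] ≤ C i`, on the lower steps because `x ∈ Q`, and on the top step because `Q` is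
    -- normal.
    let D : ℕ → Subgroup P := fun j => if j ≤ i then C j else if j = i + 1 then Q else ⊤
    have hDi : ∀ j ≤ i, D j = C j := fun j hj => if_pos hj
    have hDQ : D (i + 1) = Q := by simp [D]
    have hDT : D (i + 2) = ⊤ := by simp [D]
    have hD : ∀ j, F.AutInvariant T hT (D j) := by
      intro j
      by_cases hj : j ≤ i
      · rw [hDi j hj]
        exact (hCw j (by omega)).autInvariant hT ((hC.le hj (by omega)).trans hiT)
      · by_cases hj' : j = i + 1
        · rw [hj', hDQ]
          exact hQ.autInvariant hT
        · exact fun _ _ _ => by simp [D, hj, hj']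
    refine le_of_forall_mem_normalizer hP fun x hxC hx => ?_
    obtain ⟨α, -, hα⟩ := exists_aut_conj hF hT hx
    have hxQ : x ∈ Q := hC.2.1 ▸ hC.le hi le_rfl hxC
    refine hr.mem_of_aut_mem hF hc (chainStabilizer_normal (m := i + 2) hD)
      (isPGroup_of_forall_exists_pow_fix fun β hβ => ?_) (α := α) (fun j hj t ht => ?_) hα
    · obtain ⟨k, hk⟩ := exists_pow_fix_of_mem_chainStabilizer hP hβ ⟨0, fun t ht => by
        rw [hDi 0 (by omega), hC.1, Subgroup.mem_bot] at ht
        obtain rfl : t = 1 := Subtype.ext ht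
        simp⟩
      exact ⟨k, fun t => hk t (hDT ▸ Subgroup.mem_top _)⟩
    · rw [hα]
      rcases (by omega : j + 1 ≤ i ∨ j = i ∨ j = i + 1) with h | rfl | rfl
      · rw [hDi _ h] at ht
        rw [hDi j (by omega)]
        have := (hC.2.2 j (by omega)).2 (Subgroup.commutator_mem_commutator (inv_mem ht)
          (inv_mem hxQ))
        simpa [commutatorElement_def, mul_assoc] using this
      · rw [hDQ] at ht
        rw [hDi j le_rfl]
        have := (hC.2.2 j (by omega)).2 (Subgroup.commutator_comm (C (j + 1)) Q ▸
          Subgroup.commutator_mem_commutator (inv_mem ht) (inv_mem hxC))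
        simpa [commutatorElement_def, mul_assoc] using this
      · rw [hDQ]
        have := mul_mem (hQn.conj_mem _ (inv_mem hxQ) (t : P)⁻¹) hxQ
        simpa [mul_assoc] using this
  exact hC.2.1 ▸ key n le_rfl

theorem exists_isCentralSeries_map_upperCentralSeries [Finite P] {p : ℕ} [Fact p.Prime]
    (hP : IsPGroup p P) (Q : Subgroup P) : ∃ n, IsCentralSeries Q n
      fun i => (Subgroup.upperCentralSeries Q i).map Q.subtype := by
  have := (hP.to_subgroup Q).isNilpotent
  obtain ⟨n, hn⟩ := Group.IsNilpotent.nilpotent Q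
  refine ⟨n, by simp, ?_, fun i _ => ⟨Subgroup.map_mono
    (Subgroup.upperCentralSeries_mono Q i.le_succ), ?_⟩⟩
  · simp only [hn]
    rw [← MonoidHom.range_eq_map, Subgroup.range_subtype]
  · rw [Subgroup.commutator_le]
    rintro _ ⟨x, hx, rfl⟩ y hy
    exact ⟨_, Subgroup.mem_upperCentralSeries_succ_iff.1 hx ⟨y, hy⟩, rfl⟩

end ChainStabilizers

end FusionSystem

/-! ### The equivalence of the five conditions -/

theorem theoremC {P : Type*} [Group P] [Finite P] (p : ℕ) [Fact p.Prime] (hP : IsPGroup p P)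
    (F : FusionSystem P) (hF : F.base = ⊤) (hsat : F.IsSaturated p) (Q : Subgroup P) :
    List.TFAE [
      F = F.normalizer Q (FusionSystem.le_base_of_eq_top hF Q),
      (FusionSystem.inner Q).IsNormalIn p F,
      F.IsStronglyClosed Q ∧ ∀ T : Subgroup P,
        F.IsFullyNormalized T → F.IsCentric T → F.IsRadical p T → Q ≤ T,
      ∃ (n : ℕ) (C : ℕ → Subgroup P), FusionSystem.IsCentralSeries Q n C ∧
        ∀ i ≤ n, F.IsStronglyClosed (C i),
      F.IsStronglyClosed Q ∧ ∃ (n : ℕ) (C : ℕ → Subgroup P),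
        FusionSystem.IsCentralSeries Q n C ∧ ∀ i ≤ n, F.IsWeaklyClosed (C i)] := by
  tfae_have 1 → 2 := fun h => FusionSystem.inner_isNormalIn_of_eq_normalizer hP h hF
  tfae_have 2 → 3 := fun h => ⟨h.1.2.1, fun T _ hc hr =>
    FusionSystem.le_of_inner_isInvariant hP hF h.1 hc hr⟩
  tfae_have 3 → 1 := fun h => FusionSystem.eq_normalizer_of_extendsToSup hF h.1
    (hsat.extendsToSup hP hF h.1 h.2)
  tfae_have 1 → 4 := fun h => by
    obtain ⟨n, hn⟩ := FusionSystem.exists_isCentralSeries_map_upperCentralSeries hP Q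
    exact ⟨n, _, hn, fun i _ => FusionSystem.isStronglyClosed_of_eq_normalizer h hF _⟩
  tfae_have 4 → 5 := fun ⟨n, C, hC, h⟩ =>
    ⟨hC.2.1 ▸ h n le_rfl, n, C, hC, fun i hi => (h i hi).isWeaklyClosed⟩
  tfae_have 5 → 3 := fun ⟨hQ, n, C, hC, h⟩ => ⟨hQ, fun T _ hc hr =>
    FusionSystem.le_of_isCentralSeries hP hF hQ hC h hc hr⟩
  tfae_finish
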